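/- Let $N\ge 1$, $s\in(0,1)$ and $\alpha\in(0,1)$ with $1<2s+\alpha<2$. Let $\Omega\subset\mathbb{R}^N$ be an open set with boundary of class $C^{2s+\alpha}$: near each point of $\partial\Omega$, in suitable Cartesian coordinates, $\Omega$ is the region above the graph of a $C^{2s+\alpha}$ function. Suppose that $\Omega$ is bounded or, if it is unbounded, that the radii of these neighbourhoods and the bounds on the gradients of the graph functions and on the $(2s+\alpha-1)$-Hölder seminorms of these gradients can be chosen uniformly along $\partial\Omega$ (as for a half-space). For $u\in C^{2s+\alpha}(\overline\Omega)$ put $$\|u\|_{C^{2s+\alpha}(\overline\Omega)}=\sup_\Omega|u|+\sup_\Omega|\nabla u|+[\nabla u]_{C^{2s+\alpha-1}(\Omega)},\qquad \|f\|_{C^{\alpha}(\overline\Omega)}=\sup_{\overline\Omega}|f|+[f]_{C^{\alpha}(\overline\Omega)},$$ and $$(-\Delta)^s_\Omega u(x)=c_{N,s}\lim_{\varepsilon\to0^+}\int_{\Omega\setminus B_\varepsilon(x)}\frac{u(x)-u(y)}{|x-y|^{N+2s}}\,dy,\qquad c_{N,s}=\frac{s\,4^s\,\Gamma(\frac N2+s)}{\pi^{N/2}\,\Gamma(1-s)}.$$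 Then there is a constant $C$ depending only on $N$, $s$, $\alpha$ and $\Omega$ such that, for every $u\in C^{2s+\alpha}(\overline\Omega)$ with $\partial_\nu u=0$ on $\partial\Omega$ ($\nu$ the outer unit normal), the integrals above converge absolutely and their limit exists for every $x\in\overline\Omega$, $(-\Delta)^s_\Omega u\in C^\alpha(\overline\Omega)$, and $$\|(-\Delta)^s_\Omega u\|_{C^\alpha(\overline\Omega)}\le C\,\|u\|_{C^{2s+\alpha}(\overline\Omega)}.$$ -/

import Mathlib

open Set Filter Topology MeasureTheory
open scoped NNReal ENNReal

noncomputable section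

namespace RegionalFL

/-- The Euclidean space `ℝ^N`. -/
abbrev Eu (N : ℕ) : Type := EuclideanSpace ℝ (Fin N)

/-- The supremum norm of `f` on `S`, with values in `[0, ∞]`. -/
def supNorm {N : ℕ} {F : Type} [NormedAddCommGroup F] (S : Set (Eu N)) (f : Eu N → F) : ℝ≥0∞ :=
  ⨆ x ∈ S, ‖f x‖ₑ

/-- The norm `‖f‖_{C^α(S)} = sup_S |f| + [f]_{C^α(S)}` for `0 < α < 1`, with values in `[0, ∞]`;
it is finite exactly when `f` is bounded and `α`-Hölder continuous on `S`. -/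
def holderNorm {N : ℕ} {F : Type} [NormedAddCommGroup F] (α : ℝ) (S : Set (Eu N))
    (f : Eu N → F) : ℝ≥0∞ :=
  supNorm S f + eHolderNorm α.toNNReal (S.domRestrict f)

/-- The norm `‖u‖_{C^γ(Ω̄)} = sup_Ω |u| + sup_Ω |∇u| + [∇u]_{C^{γ-1}(Ω)}` for `1 < γ < 2`. -/
def c1HolderNorm {N : ℕ} (γ : ℝ) (Ω : Set (Eu N)) (u : Eu N → ℝ) : ℝ≥0∞ :=
  supNorm Ω u + holderNorm (γ - 1) Ω (gradient u)

/-- `u ∈ C^γ(Ω̄)` for `1 < γ < 2` and `Ω` open: `u` is continuous on `Ω̄`, differentiable in `Ω`,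
and its `C^γ(Ω̄)` norm is finite. Values of `u` outside `Ω̄` play no role. -/
structure MemC1Holder {N : ℕ} (γ : ℝ) (Ω : Set (Eu N)) (u : Eu N → ℝ) : Prop where
  continuousOn : ContinuousOn u (closure Ω)
  differentiableOn : DifferentiableOn ℝ u Ω
  norm_lt_top : c1HolderNorm γ Ω u < ⊤

/-- Inside the ball of radius `R` about `x₀`, the set `Ω` is the region above the graph of a
`C^γ` function `g` (`1 < γ < 2`) over the hyperplane orthogonal to a unit vector `e`, where
`|∇g| ≤ L` and `[∇g]_{C^{γ-1}} ≤ L`. The point `y - ⟨e, y⟩ e` is the projection of `y` to the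
hyperplane; only the values of `g` on the hyperplane matter. -/
def HasGraphChart {N : ℕ} (γ : ℝ) (Ω : Set (Eu N)) (x₀ : Eu N) (R : ℝ) (L : ℝ≥0) : Prop :=
  ∃ (e : Eu N) (g : Eu N → ℝ), ‖e‖ = 1 ∧ Differentiable ℝ g ∧
    (∀ z, ‖gradient g z‖ ≤ L) ∧ HolderWith L (γ - 1).toNNReal (gradient g) ∧
    ∀ y ∈ Metric.ball x₀ R, y ∈ Ω ↔ g (y - inner ℝ e y • e) < inner ℝ e y

/-- `Ω` is an open set with `C^γ` boundary, `1 < γ < 2`: near each of its boundary points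
it is the region above the graph of a `C^γ` function, in suitable Cartesian coordinates. -/
def IsHolderDomain {N : ℕ} (γ : ℝ) (Ω : Set (Eu N)) : Prop :=
  IsOpen Ω ∧ ∀ x₀ ∈ frontier Ω, ∃ (R : ℝ) (L : ℝ≥0), 0 < R ∧ HasGraphChart γ Ω x₀ R L

/-- The radius and the `C^γ` bound of the boundary charts can be chosen uniformly along `∂Ω`. -/
def HasUniformCharts {N : ℕ} (γ : ℝ) (Ω : Set (Eu N)) : Prop :=
  ∃ (R : ℝ) (L : ℝ≥0), 0 < R ∧ ∀ x₀ ∈ frontier Ω, HasGraphChart γ Ω x₀ R L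

/-- `ν` is the outer unit normal of `Ω` at `x`: near `x`, every open cone around `-ν` inside the
half-space `⟨y - x, ν⟩ < 0` lies in `Ω`, and every such cone around `ν` lies outside `Ω`. -/
def IsOuterUnitNormal {N : ℕ} (Ω : Set (Eu N)) (x ν : Eu N) : Prop :=
  ‖ν‖ = 1 ∧ ∀ ε : ℝ, 0 < ε → ∀ᶠ y in 𝓝 x,
    (inner ℝ (y - x) ν < -ε * ‖y - x‖ → y ∈ Ω) ∧ (ε * ‖y - x‖ < inner ℝ (y - x) ν → y ∉ Ω)

/-- `∂_ν u = 0` on `∂Ω`, for `u ∈ C^1(Ω̄)`: the continuous extension of `∇u` from `Ω` to `∂Ω`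
has vanishing component along the outer unit normal. -/
def NeumannZero {N : ℕ} (Ω : Set (Eu N)) (u : Eu N → ℝ) : Prop :=
  ∀ x ∈ frontier Ω, ∀ ν, IsOuterUnitNormal Ω x ν →
    Tendsto (fun y => inner ℝ (gradient u y) ν) (𝓝[Ω] x) (𝓝 0)

/-- The constant `c_{N,s} = s 4^s Γ(N/2 + s) / (π^{N/2} Γ(1 - s))`. -/
def cNs (N : ℕ) (s : ℝ) : ℝ :=
  s * (4 : ℝ) ^ s * Real.Gamma ((N : ℝ) / 2 + s) /
    (Real.pi ^ ((N : ℝ) / 2) * Real.Gamma (1 - s))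

/-- The integrand `(u(x) - u(y)) / |x - y|^{N + 2s}`. -/
def integrand {N : ℕ} (s : ℝ) (u : Eu N → ℝ) (x y : Eu N) : ℝ :=
  (u x - u y) / ‖x - y‖ ^ ((N : ℝ) + 2 * s)

/-- The truncation `c_{N,s} ∫_{Ω \ B_ε(x)} (u(x) - u(y)) / |x - y|^{N + 2s} dy`. -/
def truncated {N : ℕ} (s : ℝ) (Ω : Set (Eu N)) (u : Eu N → ℝ) (x : Eu N) (ε : ℝ) : ℝ :=
  cNs N s * ∫ y in Ω \ Metric.ball x ε, integrand s u x y

/-- The regional fractional Laplacian `(-Δ)^s_Ω u(x)`: the limit of the truncations as `ε → 0+`. -/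
def regionalFracLap {N : ℕ} (s : ℝ) (Ω : Set (Eu N)) (u : Eu N → ℝ) (x : Eu N) : ℝ :=
  limUnder (𝓝[>] (0 : ℝ)) (truncated s Ω u x)

/-- `(-Δ)^s_Ω u(x)` is well defined: the truncated integrals converge absolutely, and they have
a limit as `ε → 0+`, which is then `regionalFracLap s Ω u x`. -/
def IsDefinedAt {N : ℕ} (s : ℝ) (Ω : Set (Eu N)) (u : Eu N → ℝ) (x : Eu N) : Prop :=
  (∀ ε : ℝ, 0 < ε → IntegrableOn (integrand s u x) (Ω \ Metric.ball x ε)) ∧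
    Tendsto (truncated s Ω u x) (𝓝[>] (0 : ℝ)) (𝓝 (regionalFracLap s Ω u x))

end RegionalFL

end

namespace RegionalFL

/-! Write γ = 2s + α, p = N + 2s, and let M bound the C^γ norm of u. Cap the kernel |x - y|^(-p) at
scale ρ by replacing |x - y| with max(|x - y|, ρ), and halve the cap repeatedly. Passing from cap r
to cap r/2 changes the kernel only where |x - y| ≤ r, by a radial function of size r^(-p). Since
u(x) - u(y) = O(M r) there, the crude bound on the increment is M r^(1-2s). This falls short of r^α,
because α > 1 - 2s, so cancellation must supply the rest.

The cancellation comes from a flat model at scale r. There u is affine with gradient a up to an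
error M r^γ. Away from the boundary Ω is replaced by the whole space, and near it by a half-space H,
with an error of volume r^(N-1+γ). The Neumann condition makes a tangent to H, so H is invariant
under translation along a. Reflection in the hyperplane orthogonal to a, centred at any point, then
preserves H and the radial kernel and reverses the linear part, whose integral over H therefore
vanishes (`integral_inner_radial_eq_zero`). Both errors contribute M r^(N+γ-p) = M r^α to the
increment (`IsFlatModel.abs_integral_le`). As the centre of the reflection is free, one model serves
two points x, z with |x - z| ≤ r, and the difference of their increments gains a factor |x - z|/r
(`IsFlatModel.abs_integral_sub_le`).

These two bounds at the scales r₀/2^n are the dyadic characterization of a C^α limit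
(`exists_holder_limit`). The sharp truncation at ε between r/2 and r differs from the operator
capped at r by a kernel of the same type, so it has the same limit (`tendsto_of_dyadic`). Models at
all small scales, with uniform constants, come from the uniform charts
(`HasUniformCharts.exists_isFlatModel`). -/

/-! ### Pointwise bounds from the norms, and mean value inequalities -/

/-- The real inequalities contained in a bound `M` for the `C^γ(Ω̄)` norm of `u`. -/
structure C1HolderBound {N : ℕ} (γ M : ℝ) (Ω : Set (Eu N)) (u : Eu N → ℝ) : Prop where
  continuousOn : ContinuousOn u (closure Ω)
  differentiableOn : DifferentiableOn ℝ u Ω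
  abs_le : ∀ x ∈ closure Ω, |u x| ≤ M
  norm_gradient_le : ∀ x ∈ Ω, ‖gradient u x‖ ≤ M
  norm_gradient_sub_le : ∀ x ∈ Ω, ∀ y ∈ Ω,
    ‖gradient u x - gradient u y‖ ≤ M * ‖x - y‖ ^ (γ - 1)

lemma norm_le_toReal_supNorm {N : ℕ} {F : Type} [NormedAddCommGroup F] {S : Set (Eu N)}
    {f : Eu N → F} (h : supNorm S f ≠ ⊤) {x : Eu N} (hx : x ∈ S) :
    ‖f x‖ ≤ (supNorm S f).toReal := by
  have h1 : ‖f x‖ₑ ≤ supNorm S f := le_iSup₂ (f := fun x (_ : x ∈ S) => ‖f x‖ₑ) x hx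
  have := ENNReal.toReal_mono h h1
  simpa using this

lemma MemC1Holder.c1HolderBound {N : ℕ} {γ : ℝ} (hγ : 1 < γ) {Ω : Set (Eu N)} {u : Eu N → ℝ}
    (hu : MemC1Holder γ Ω u) : C1HolderBound γ (c1HolderNorm γ Ω u).toReal Ω u := by
  have htop := hu.norm_lt_top
  have hfin : c1HolderNorm γ Ω u ≠ ⊤ := htop.ne
  unfold c1HolderNorm holderNorm at htop
  have h1 := (ENNReal.add_lt_top.1 htop).1
  have h23 := ENNReal.add_lt_top.1 (ENNReal.add_lt_top.1 htop).2
  have hle1 : supNorm Ω u ≤ c1HolderNorm γ Ω u := le_self_add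
  have hle2 : supNorm Ω (gradient u) ≤ c1HolderNorm γ Ω u := le_self_add.trans le_add_self
  have hle3 : eHolderNorm (γ - 1).toNNReal (Ω.domRestrict (gradient u)) ≤ c1HolderNorm γ Ω u :=
    le_add_self.trans le_add_self
  refine ⟨hu.continuousOn, hu.differentiableOn, ?_, ?_, ?_⟩
  · have hΩ : ∀ x ∈ Ω, u x ∈ Icc (-(c1HolderNorm γ Ω u).toReal) (c1HolderNorm γ Ω u).toReal := by
      intro x hx
      have := (norm_le_toReal_supNorm h1.ne hx).trans (ENNReal.toReal_mono hfin hle1)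
      rw [Real.norm_eq_abs, abs_le] at this
      exact this
    intro x hx
    -- The norm only controls u on Ω; continuity carries the bound to the closure, where the
    -- operator is evaluated.
    have hm := hu.continuousOn.image_closure (mem_image_of_mem u hx)
    have hsub : closure (u '' Ω) ⊆
        Icc (-(c1HolderNorm γ Ω u).toReal) (c1HolderNorm γ Ω u).toReal :=
      closure_minimal (image_subset_iff.2 hΩ) isClosed_Icc
    exact abs_le.2 (hsub hm)
  · intro x hx
    exact (norm_le_toReal_supNorm h23.1.ne hx).trans (ENNReal.toReal_mono hfin hle2)
  · intro x hx y hy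
    have hH := (eHolderNorm_lt_top.1 h23.2).holderWith
    have hd := hH.dist_le ⟨x, hx⟩ ⟨y, hy⟩
    rw [Real.coe_toNNReal _ (by linarith), Subtype.dist_eq] at hd
    simp only [Set.domRestrict_apply, dist_eq_norm] at hd
    refine hd.trans (mul_le_mul_of_nonneg_right ?_ (Real.rpow_nonneg (norm_nonneg _) _))
    have h4 : ((nnHolderNorm (γ - 1).toNNReal (Ω.domRestrict (gradient u)) : ℝ≥0) : ℝ≥0∞) ≤
        c1HolderNorm γ Ω u := coe_nnHolderNorm_le_eHolderNorm.trans hle3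
    simpa using ENNReal.toReal_mono hfin h4

lemma C1HolderBound.nonneg {N : ℕ} {γ M : ℝ} {Ω : Set (Eu N)} {u : Eu N → ℝ}
    (h : C1HolderBound γ M Ω u) {x : Eu N} (hx : x ∈ closure Ω) : 0 ≤ M :=
  (abs_nonneg _).trans (h.abs_le x hx)

/-- The mean value inequality for f minus the linear function of a. Only the segment matters, so Ω
need not be convex. -/
lemma abs_sub_inner_le_of_gradient {N : ℕ} {f : Eu N → ℝ} {a p q : Eu N} {η : ℝ}
    (hf : ∀ z ∈ segment ℝ p q, DifferentiableAt ℝ f z)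
    (hη : ∀ z ∈ segment ℝ p q, ‖gradient f z - a‖ ≤ η) :
    |f q - f p - inner ℝ a (q - p)| ≤ η * ‖q - p‖ := by
  have key := (convex_segment (𝕜 := ℝ) p q).norm_image_sub_le_of_norm_hasFDerivWithin_le'
    (f := f) (f' := fun z => InnerProductSpace.toDual ℝ (Eu N) (gradient f z))
    (φ := InnerProductSpace.toDual ℝ (Eu N) a) (C := η)
    (fun z hz => (hf z hz).hasGradientAt.hasFDerivAt.hasFDerivWithinAt)
    (fun z hz => by rw [← map_sub, LinearIsometryEquiv.norm_map]; exact hη z hz)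
    (left_mem_segment ℝ p q) (right_mem_segment ℝ p q)
  simpa [InnerProductSpace.toDual_apply_apply] using key

lemma abs_sub_inner_le_of_holder_gradient {N : ℕ} {γ : ℝ} (hγ : 1 < γ) {L : ℝ≥0} {g : Eu N → ℝ}
    (hg : Differentiable ℝ g) (hL : HolderWith L (γ - 1).toNNReal (gradient g)) (p q : Eu N) :
    |g q - g p - inner ℝ (gradient g p) (q - p)| ≤ L * ‖q - p‖ ^ γ := by
  have h := abs_sub_inner_le_of_gradient (f := g) (a := gradient g p) (p := p) (q := q)
    (η := L * ‖q - p‖ ^ (γ - 1)) (fun z _ => hg z) (fun z hz => by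
      have h1 := hL.dist_le z p
      rw [Real.coe_toNNReal _ (by linarith), dist_eq_norm, dist_eq_norm] at h1
      refine h1.trans ?_
      gcongr
      rw [segment_eq_image'] at hz
      obtain ⟨t, ht, rfl⟩ := hz
      rw [add_sub_cancel_left, norm_smul, Real.norm_of_nonneg ht.1]
      exact mul_le_of_le_one_left (norm_nonneg _) ht.2)
  refine h.trans (le_of_eq ?_)
  rcases (norm_nonneg (q - p)).eq_or_lt with h0 | h0
  · rw [← h0, Real.zero_rpow (by linarith : γ ≠ 0)]; simp
  · rw [mul_assoc, ← Real.rpow_add_one h0.ne']; simp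

/-! ### Graph charts, defining functions and outer normals -/

/-- The defining function of `Ω` that a graph chart at the boundary point `x₀` provides: `G` is
positive exactly in `Ω`, has slope one in the direction `e`, is Lipschitz continuous, and differs
from the linear function of its normal `n` by `O(‖y - x₀‖ ^ γ)`. -/
structure IsDefiningFunction {N : ℕ} (γ : ℝ) (Ω : Set (Eu N)) (x₀ : Eu N) (R L : ℝ) (e n : Eu N)
    (G : Eu N → ℝ) : Prop where
  norm_dir : ‖e‖ = 1
  mem_iff : ∀ y ∈ Metric.ball x₀ R, y ∈ Ω ↔ 0 < G y
  add_smul : ∀ y t, G (y + t • e) = G y + t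
  lipschitz : ∀ p q, |G p - G q| ≤ (1 + L) * ‖p - q‖
  one_le_norm : 1 ≤ ‖n‖
  abs_sub_le : ∀ y, |G y - inner ℝ n (y - x₀)| ≤ L * ‖y - x₀‖ ^ γ

lemma norm_sub_inner_smul_le {N : ℕ} {e : Eu N} (he : ‖e‖ = 1) (v : Eu N) :
    ‖v - inner ℝ e v • e‖ ≤ ‖v‖ := by
  have h1 : ‖v - inner ℝ e v • e‖ ^ 2 = ‖v‖ ^ 2 - (inner ℝ e v) ^ 2 := by
    rw [norm_sub_sq_real, norm_smul, inner_smul_right, real_inner_comm, he, Real.norm_eq_abs,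
      mul_one, sq_abs]
    ring
  exact le_of_sq_le_sq (by nlinarith [sq_nonneg (inner ℝ e v : ℝ)]) (norm_nonneg _)

/-- Take G(y) = ⟨e, y⟩ - g(projection of y), the height above the graph. Its gradient at x₀ is n = e
- (tangential part of ∇g), and the Hölder bound on ∇g controls the Taylor remainder. -/
lemma HasGraphChart.exists_isDefiningFunction {N : ℕ} {γ : ℝ} (hγ : 1 < γ) {Ω : Set (Eu N)}
    (hΩ : IsOpen Ω) {x₀ : Eu N} (hx₀ : x₀ ∈ frontier Ω) {R : ℝ} (hR : 0 < R) {L : ℝ≥0}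
    (h : HasGraphChart γ Ω x₀ R L) :
    ∃ e n G, IsDefiningFunction γ Ω x₀ R L e n G := by
  obtain ⟨e, g, he, hg, hgL, hgH, hmem⟩ := h
  have hee : inner ℝ e e = (1 : ℝ) := by rw [real_inner_self_eq_norm_sq, he]; norm_num
  have hgLip : ∀ p q, |g p - g q| ≤ L * ‖p - q‖ := fun p q => by
    have := abs_sub_inner_le_of_gradient (f := g) (a := 0) (p := q) (q := p)
      (fun z _ => hg z) (fun z _ => by simpa using hgL z)
    simpa using this
  set G : Eu N → ℝ := fun y => inner ℝ e y - g (y - inner ℝ e y • e) with hG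
  have hlip : ∀ p q, |G p - G q| ≤ (1 + L) * ‖p - q‖ := by
    intro p q
    have h1 : G p - G q = inner ℝ e (p - q) -
        (g (p - inner ℝ e p • e) - g (q - inner ℝ e q • e)) := by
      simp only [hG, inner_sub_right]; ring
    have h2 : |(inner ℝ e (p - q) : ℝ)| ≤ ‖p - q‖ := by
      simpa [he] using abs_real_inner_le_norm e (p - q)
    have h3 := hgLip (p - inner ℝ e p • e) (q - inner ℝ e q • e)
    have h4 : p - (inner ℝ e p : ℝ) • e - (q - (inner ℝ e q : ℝ) • e) =
        (p - q) - (inner ℝ e (p - q) : ℝ) • e := by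
      rw [inner_sub_right, sub_smul]; abel
    rw [h4] at h3
    have h5 := mul_le_mul_of_nonneg_left (norm_sub_inner_smul_le he (p - q)) L.coe_nonneg
    rw [h1]
    refine (abs_sub _ _).trans ?_
    linarith
  have hGc : Continuous G := by
    have : LipschitzWith (1 + L) G := LipschitzWith.of_dist_le_mul fun p q => by
      rw [dist_eq_norm, dist_eq_norm]; simpa using hlip p q
    exact this.continuous
  have hmem' : ∀ y ∈ Metric.ball x₀ R, y ∈ Ω ↔ 0 < G y := fun y hy => by
    rw [hmem y hy]; simp only [hG, sub_pos]
  -- Positivity would put x₀ in the open set Ω, while negativity would keep a whole neighbourhood of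
  -- x₀ outside Ω.
  have hG0 : G x₀ = 0 := by
    apply le_antisymm
    · rw [hΩ.frontier_eq] at hx₀
      by_contra! hlt
      exact hx₀.2 ((hmem' x₀ (Metric.mem_ball_self hR)).2 hlt)
    · by_contra! hlt
      have hev : ∀ᶠ y in 𝓝 x₀, G y < 0 ∧ y ∈ Metric.ball x₀ R :=
        (hGc.continuousAt.eventually_lt_const hlt).and (Metric.ball_mem_nhds _ hR)
      obtain ⟨y, hy, hyΩ⟩ := mem_closure_iff_nhds.1 hx₀.1 _ hev
      exact absurd ((hmem' y hy.2).1 hyΩ) (not_lt.2 hy.1.le)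
  set b := gradient g (x₀ - inner ℝ e x₀ • e) with hb
  refine ⟨e, e - (b - inner ℝ e b • e), G, he, hmem', ?_, hlip, ?_, ?_⟩
  · intro y t
    simp only [hG, inner_add_right, inner_smul_right, hee]
    have : y + t • e - (inner ℝ e y + t * 1 : ℝ) • e = y - (inner ℝ e y : ℝ) • e := by
      rw [mul_one, _root_.add_smul]; abel
    rw [this]; ring
  -- Pairing n with the unit vector e gives 1, whence |n| ≥ 1.
  · have h1 : inner ℝ (e - (b - (inner ℝ e b : ℝ) • e)) e = (1 : ℝ) := by
      simp only [inner_sub_left, inner_smul_left, hee, real_inner_comm b e]; simp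
    have h2 := real_inner_le_norm (e - (b - (inner ℝ e b : ℝ) • e)) e
    rw [h1, he, mul_one] at h2
    exact h2
  · intro y
    have ht := abs_sub_inner_le_of_holder_gradient hγ hg hgH (x₀ - inner ℝ e x₀ • e)
      (y - inner ℝ e y • e)
    have h4 : y - (inner ℝ e y : ℝ) • e - (x₀ - (inner ℝ e x₀ : ℝ) • e) =
        (y - x₀) - (inner ℝ e (y - x₀) : ℝ) • e := by
      rw [inner_sub_right, sub_smul]; abel
    rw [h4] at ht
    have h6 : G y - inner ℝ (e - (b - (inner ℝ e b : ℝ) • e)) (y - x₀) =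
        - (g (y - (inner ℝ e y : ℝ) • e) - g (x₀ - (inner ℝ e x₀ : ℝ) • e) -
          inner ℝ b ((y - x₀) - (inner ℝ e (y - x₀) : ℝ) • e)) := by
      have h7 : G y = G y - G x₀ := by rw [hG0, sub_zero]
      rw [h7]
      simp only [hG, inner_sub_left, inner_sub_right, inner_smul_left, inner_smul_right,
        real_inner_comm b e]
      simp
      ring
    rw [h6, abs_neg]
    refine ht.trans ?_
    gcongr
    exact norm_sub_inner_smul_le he _

/-- The outer unit normal in a graph chart. -/
lemma IsDefiningFunction.isOuterUnitNormal {N : ℕ} {γ : ℝ} (hγ : 1 < γ) {Ω : Set (Eu N)}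
    {x₀ : Eu N} {R L : ℝ} (hR : 0 < R) {e n : Eu N} {G : Eu N → ℝ}
    (h : IsDefiningFunction γ Ω x₀ R L e n G) : IsOuterUnitNormal Ω x₀ (-(‖n‖⁻¹ • n)) := by
  have hn : 0 < ‖n‖ := lt_of_lt_of_le one_pos h.one_le_norm
  refine ⟨by rw [norm_neg, norm_smul, norm_inv, norm_norm, inv_mul_cancel₀ hn.ne'], ?_⟩
  intro ε hε
  have hlim : Tendsto (fun y : Eu N => L * ‖y - x₀‖ ^ (γ - 1)) (𝓝 x₀) (𝓝 0) := by
    have : ContinuousAt (fun y : Eu N => L * ‖y - x₀‖ ^ (γ - 1)) x₀ := by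
      refine continuousAt_const.mul (ContinuousAt.rpow_const (by fun_prop) (Or.inr (by linarith)))
    have h2 := this.tendsto
    simpa [Real.zero_rpow (by linarith : γ - 1 ≠ 0)] using h2
  filter_upwards [hlim.eventually_lt_const hε, Metric.ball_mem_nhds x₀ hR] with y hy hyR
  have habs := abs_le.1 (h.abs_sub_le y)
  have hpow : L * ‖y - x₀‖ ^ γ ≤ ε * ‖y - x₀‖ := by
    rcases (norm_nonneg (y - x₀)).eq_or_lt with h0 | h0
    · rw [← h0, Real.zero_rpow (by linarith : γ ≠ 0)]; simp
    · have : ‖y - x₀‖ ^ γ = ‖y - x₀‖ ^ (γ - 1) * ‖y - x₀‖ := by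
        rw [← Real.rpow_add_one h0.ne']; simp
      rw [this, ← mul_assoc]
      exact mul_le_mul_of_nonneg_right hy.le h0.le
  have hin : (inner ℝ (y - x₀) (-(‖n‖⁻¹ • n)) : ℝ) * ‖n‖ = - inner ℝ n (y - x₀) := by
    rw [inner_neg_right, inner_smul_right, real_inner_comm]
    field_simp
  have hεn : ε * ‖y - x₀‖ ≤ ε * ‖y - x₀‖ * ‖n‖ :=
    le_mul_of_one_le_right (by positivity) h.one_le_norm
  constructor
  · intro hlt
    rw [h.mem_iff y hyR]
    have := mul_lt_mul_of_pos_right hlt hn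
    rw [hin] at this
    nlinarith
  · intro hlt
    rw [h.mem_iff y hyR, not_lt]
    have := mul_lt_mul_of_pos_right hlt hn
    rw [hin] at this
    nlinarith

/-- Mean value inequality along a path that leaves the boundary, crosses, and returns. -/
lemma IsDefiningFunction.abs_sub_inner_le {N : ℕ} {γ : ℝ} {Ω : Set (Eu N)} {x₀ : Eu N}
    {R L : ℝ} (hL : 0 ≤ L) {e n : Eu N} {G : Eu N → ℝ}
    (h : IsDefiningFunction γ Ω x₀ R L e n G) (hΩ : IsOpen Ω) {u : Eu N → ℝ}
    (hu : DifferentiableOn ℝ u Ω) {ρ η : ℝ} (hρR : (3 + 2 * L) * ρ ≤ R) {a : Eu N}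
    (ha : ∀ z ∈ Ω ∩ Metric.ball x₀ ((3 + 2 * L) * ρ), ‖gradient u z - a‖ ≤ η) {p q : Eu N}
    (hp : p ∈ Ω ∩ Metric.ball x₀ ρ) (hq : q ∈ Ω ∩ Metric.ball x₀ ρ) :
    |u q - u p - inner ℝ a (q - p)| ≤ (3 + 2 * L) * η * ‖q - p‖ := by
  have hρ : 0 < ρ := Metric.pos_of_mem_ball hp.2
  have hp2 : ‖p - x₀‖ < ρ := by simpa [dist_eq_norm] using hp.2
  have hq2 : ‖q - x₀‖ < ρ := by simpa [dist_eq_norm] using hq.2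
  have hpq : ‖q - p‖ ≤ 2 * ρ := by
    have : q - p = (q - x₀) - (p - x₀) := by abel
    rw [this]; refine (norm_sub_le _ _).trans (by linarith)
  -- Lifting both points by T in the direction e raises G by T, which exceeds or equals any loss of
  -- G along a segment of length |q - p|. The lifted segment thus stays in Ω. The path has length 2T
  -- + |q - p| = (3 + 2L)|q - p|.
  set T := (1 + L) * ‖q - p‖ with hT
  have hT0 : 0 ≤ T := by positivity
  have hTe : ‖T • e‖ = T := by rw [norm_smul, h.norm_dir, Real.norm_of_nonneg hT0, mul_one]
  have hT2 : T ≤ (2 + 2 * L) * ρ := by rw [hT]; nlinarith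
  have hball : ∀ v : Eu N, ‖v - x₀‖ < ρ → v + T • e ∈ Metric.ball x₀ ((3 + 2 * L) * ρ) := by
    intro v hv
    rw [mem_ball_iff_norm]
    have : v + T • e - x₀ = (v - x₀) + T • e := by abel
    rw [this]
    refine (norm_add_le _ _).trans_lt ?_
    rw [hTe]; nlinarith
  have hball0 : ∀ v : Eu N, ‖v - x₀‖ < ρ → v ∈ Metric.ball x₀ ((3 + 2 * L) * ρ) := by
    intro v hv
    rw [mem_ball_iff_norm]
    nlinarith
  have hsub := Metric.ball_subset_ball (x := x₀) hρR
  have hconv := convex_ball x₀ ((3 + 2 * L) * ρ)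
  have hup : ∀ v ∈ Ω, ‖v - x₀‖ < ρ → ∀ z ∈ segment ℝ v (v + T • e),
      z ∈ Ω ∩ Metric.ball x₀ ((3 + 2 * L) * ρ) := by
    intro v hvΩ hv z hz
    have hzb := hconv.segment_subset (hball0 v hv) (hball v hv) hz
    refine ⟨?_, hzb⟩
    rw [segment_eq_image'] at hz
    obtain ⟨t, ht, rfl⟩ := hz
    beta_reduce at hzb ⊢
    rw [h.mem_iff _ (hsub hzb), add_sub_cancel_left, smul_smul, h.add_smul]
    have := (h.mem_iff v (hsub (hball0 v hv))).1 hvΩ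
    have h3 := mul_nonneg ht.1 hT0
    linarith
  have hacross : ∀ z ∈ segment ℝ (p + T • e) (q + T • e),
      z ∈ Ω ∩ Metric.ball x₀ ((3 + 2 * L) * ρ) := by
    intro z hz
    have hzb := hconv.segment_subset (hball p hp2) (hball q hq2) hz
    refine ⟨?_, hzb⟩
    rw [segment_eq_image'] at hz
    obtain ⟨t, ht, rfl⟩ := hz
    beta_reduce at hzb ⊢
    rw [h.mem_iff _ (hsub hzb), add_sub_add_right_eq_sub, add_right_comm, h.add_smul]
    have h1 := (h.mem_iff p (hsub (hball0 p hp2))).1 hp.1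
    have h2 := (abs_le.1 (h.lipschitz (p + t • (q - p)) p)).1
    rw [add_sub_cancel_left, norm_smul, Real.norm_of_nonneg ht.1] at h2
    have h3 : (1 + L) * (t * ‖q - p‖) ≤ T := by
      rw [hT]
      gcongr
      exact mul_le_of_le_one_left (norm_nonneg _) ht.2
    linarith
  have hd : ∀ z ∈ Ω, DifferentiableAt ℝ u z := fun z hz => hu.differentiableAt (hΩ.mem_nhds hz)
  have k1 := abs_sub_inner_le_of_gradient (fun z hz => hd z (hup p hp.1 hp2 z hz).1)
    (fun z hz => ha z (hup p hp.1 hp2 z hz))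
  have k2 := abs_sub_inner_le_of_gradient (fun z hz => hd z (hup q hq.1 hq2 z hz).1)
    (fun z hz => ha z (hup q hq.1 hq2 z hz))
  have k3 := abs_sub_inner_le_of_gradient (fun z hz => hd z (hacross z hz).1)
    (fun z hz => ha z (hacross z hz))
  rw [add_sub_cancel_left, hTe] at k1 k2
  rw [add_sub_add_right_eq_sub] at k3
  have hfin : (3 + 2 * L) * η * ‖q - p‖ = η * T + η * T + η * ‖q - p‖ := by rw [hT]; ring
  rw [hfin]
  rw [abs_le] at k1 k2 k3 ⊢
  constructor <;> linarith [k1.1, k1.2, k2.1, k2.2, k3.1, k3.2]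

/-! ### Flat models at small scales -/

/-- In an orthonormal basis whose first vector is n/|n|, the set lies in a box with one side 2t and
N - 1 sides 2ρ. -/
lemma volume_slab_le {N : ℕ} (hN : 1 ≤ N) {n x₀ : Eu N} (hn : 1 ≤ ‖n‖) {t ρ : ℝ} (ht : 0 ≤ t)
    (hρ : 0 ≤ ρ) :
    volume {y : Eu N | |inner ℝ n (y - x₀)| ≤ t ∧ ‖y - x₀‖ ≤ ρ} ≤
      ENNReal.ofReal (2 * t * (2 * ρ) ^ (N - 1)) := by
  obtain ⟨k, rfl⟩ : ∃ k, N = k + 1 := ⟨N - 1, by omega⟩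
  have hn0 : 0 < ‖n‖ := lt_of_lt_of_le one_pos hn
  set v : Fin (k + 1) → Eu (k + 1) := fun _ => ‖n‖⁻¹ • n with hv
  have hvn : ‖‖n‖⁻¹ • n‖ = 1 := by
    rw [norm_smul, norm_inv, norm_norm, inv_mul_cancel₀ hn0.ne']
  have horth : Orthonormal ℝ (({0} : Set (Fin (k + 1))).domRestrict v) := by
    refine ⟨fun i => hvn, fun i j hij => ?_⟩
    exact absurd (Subsingleton.elim i j) hij
  obtain ⟨b, hb⟩ := horth.exists_orthonormalBasis_extension_of_card_eq (by simp)
  have hb0 : b 0 = ‖n‖⁻¹ • n := hb 0 rfl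
  have hmp : MeasurePreserving (fun y : Eu (k + 1) => (b.repr (y - x₀)).ofLp) volume volume :=
    (PiLp.volume_preserving_ofLp (Fin (k + 1))).comp
      (b.measurePreserving_repr.comp (measurePreserving_sub_right volume x₀))
  set c : Fin (k + 1) → ℝ := Fin.cons t (fun _ => ρ) with hc
  have hsub : {y : Eu (k + 1) | |inner ℝ n (y - x₀)| ≤ t ∧ ‖y - x₀‖ ≤ ρ} ⊆
      (fun y : Eu (k + 1) => (b.repr (y - x₀)).ofLp) ⁻¹' (Icc (-c) c) := by
    rintro y ⟨hy1, hy2⟩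
    have hall : ∀ i, |b.repr (y - x₀) i| ≤ c i := by
      intro i
      rw [b.repr_apply_apply]
      refine Fin.cases ?_ (fun j => ?_) i
      · rw [hb0, inner_smul_left, abs_mul]
        simp only [hc, Fin.cons_zero, conj_trivial]
        rw [abs_of_nonneg (inv_nonneg.2 hn0.le)]
        exact (mul_le_of_le_one_left (abs_nonneg _) (inv_le_one_of_one_le₀ hn)).trans hy1
      · simp only [hc, Fin.cons_succ]
        refine (abs_real_inner_le_norm _ _).trans ?_
        rw [b.norm_eq_one, one_mul]; exact hy2
    exact ⟨fun i => (abs_le.1 (hall i)).1, fun i => (abs_le.1 (hall i)).2⟩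
  refine (measure_mono hsub).trans (le_of_eq ?_)
  rw [hmp.measure_preimage measurableSet_Icc.nullMeasurableSet, Real.volume_Icc_pi,
    Fin.prod_univ_succ]
  simp only [hc, Pi.neg_apply, Fin.cons_zero, Fin.cons_succ, Finset.prod_const,
    Finset.card_univ, Fintype.card_fin, sub_neg_eq_add, Nat.add_sub_cancel]
  rw [ENNReal.ofReal_mul (by positivity), ENNReal.ofReal_pow (by positivity), two_mul, two_mul]

/-- At scale `r` near `x`, the function `u` is close to one with constant gradient `a`, and `Ω`
is close to a set `H` that is invariant under translations along `a`. -/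
structure IsFlatModel {N : ℕ} (γ M C : ℝ) (Ω : Set (Eu N)) (u : Eu N → ℝ) (x : Eu N) (r : ℝ)
    (a : Eu N) (H : Set (Eu N)) : Prop where
  measurableSet : MeasurableSet H
  add_smul_mem : ∀ y, ∀ t : ℝ, y + t • a ∈ H ↔ y ∈ H
  norm_le : ‖a‖ ≤ M
  abs_sub_inner_le : ∀ p ∈ closure Ω ∩ Metric.closedBall x (2 * r),
    ∀ q ∈ closure Ω ∩ Metric.closedBall x (2 * r),
      |u p - u q - inner ℝ a (p - q)| ≤ C * M * r ^ (γ - 1) * ‖p - q‖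
  volume_le : volume.real (symmDiff Ω H ∩ Metric.closedBall x (2 * r)) ≤
    C * r ^ ((N : ℝ) - 1 + γ)

/-- A Hölder continuous gradient is Cauchy along Ω at x₀. The limit inherits the size and Hölder
bounds. -/
lemma C1HolderBound.exists_limit_gradient {N : ℕ} {γ M : ℝ} (hγ : 1 < γ) {Ω : Set (Eu N)}
    {u : Eu N → ℝ} (hu : C1HolderBound γ M Ω u) {x₀ : Eu N} (hx₀ : x₀ ∈ closure Ω) :
    ∃ a, Tendsto (gradient u) (𝓝[Ω] x₀) (𝓝 a) ∧ ‖a‖ ≤ M ∧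
      ∀ z ∈ Ω, ‖gradient u z - a‖ ≤ M * ‖z - x₀‖ ^ (γ - 1) := by
  have : (𝓝[Ω] x₀).NeBot := mem_closure_iff_nhdsWithin_neBot.1 hx₀
  have hcont : ∀ z : Eu N, Tendsto (fun y : Eu N => M * ‖z - y‖ ^ (γ - 1)) (𝓝 x₀)
      (𝓝 (M * ‖z - x₀‖ ^ (γ - 1))) := fun z =>
    (continuousAt_const.mul (ContinuousAt.rpow_const (by fun_prop) (Or.inr (by linarith)))).tendsto
  have hcauchy : Cauchy (map (gradient u) (𝓝[Ω] x₀)) := by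
    rw [cauchy_map_iff]
    refine ⟨inferInstance, tendsto_uniformity_iff_dist_tendsto_zero.2 ?_⟩
    have hc : ContinuousAt (fun p : Eu N × Eu N => M * ‖p.1 - p.2‖ ^ (γ - 1)) (x₀, x₀) :=
      continuousAt_const.mul (ContinuousAt.rpow_const (by fun_prop) (Or.inr (by linarith)))
    have h0 : Tendsto (fun p : Eu N × Eu N => M * ‖p.1 - p.2‖ ^ (γ - 1))
        (𝓝[Ω] x₀ ×ˢ 𝓝[Ω] x₀) (𝓝 0) := by
      have h1 := hc.tendsto
      simp only [sub_self, norm_zero, Real.zero_rpow (by linarith : γ - 1 ≠ 0), mul_zero] at h1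
      refine h1.mono_left ?_
      rw [nhds_prod_eq]
      exact Filter.prod_mono nhdsWithin_le_nhds nhdsWithin_le_nhds
    refine squeeze_zero' (Eventually.of_forall fun _ => dist_nonneg) ?_ h0
    have hmem : ∀ᶠ p : Eu N × Eu N in 𝓝[Ω] x₀ ×ˢ 𝓝[Ω] x₀, p.1 ∈ Ω ∧ p.2 ∈ Ω :=
      (eventually_mem_nhdsWithin (a := x₀) (s := Ω)).prod_mk
        (eventually_mem_nhdsWithin (a := x₀) (s := Ω))
    filter_upwards [hmem] with p hp
    rw [dist_eq_norm]
    exact hu.norm_gradient_sub_le _ hp.1 _ hp.2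
  obtain ⟨a, ha⟩ := CompleteSpace.complete hcauchy
  have ha' : Tendsto (gradient u) (𝓝[Ω] x₀) (𝓝 a) := ha
  refine ⟨a, ha', ?_, fun z hz => ?_⟩
  · exact le_of_tendsto ha'.norm (eventually_mem_nhdsWithin.mono fun y hy =>
      hu.norm_gradient_le y hy)
  · refine le_of_tendsto_of_tendsto (tendsto_const_nhds.sub ha').norm
      ((hcont z).mono_left nhdsWithin_le_nhds) ?_
    exact eventually_mem_nhdsWithin.mono fun y hy => hu.norm_gradient_sub_le z hz y hy

lemma abs_sub_inner_le_of_mem_closure {N : ℕ} {Ω U : Set (Eu N)} {u : Eu N → ℝ}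
    (hu : ContinuousOn u (closure Ω)) (hU : IsOpen U) {a : Eu N} {K : ℝ}
    (h : ∀ p ∈ Ω ∩ U, ∀ q ∈ Ω ∩ U, |u p - u q - inner ℝ a (p - q)| ≤ K * ‖p - q‖)
    {p q : Eu N} (hp : p ∈ closure Ω ∩ U) (hq : q ∈ closure Ω ∩ U) :
    |u p - u q - inner ℝ a (p - q)| ≤ K * ‖p - q‖ := by
  have hmem : ∀ {y}, y ∈ closure Ω ∩ U → y ∈ closure (U ∩ Ω) := fun hy =>
    hU.inter_closure ⟨hy.2, hy.1⟩
  have hc : ContinuousOn u (closure (U ∩ Ω)) := hu.mono (closure_mono inter_subset_right)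
  have h1 : ∀ q ∈ U ∩ Ω, |u p - u q - inner ℝ a (p - q)| ≤ K * ‖p - q‖ := fun q hq =>
    le_on_closure (f := fun p => |u p - u q - inner ℝ a (p - q)|) (g := fun p => K * ‖p - q‖)
      (fun p hp => h p hp.symm q hq.symm)
      (((hc.sub continuousOn_const).sub (by fun_prop)).abs) (by fun_prop) (hmem hp)
  exact le_on_closure (f := fun q => |u p - u q - inner ℝ a (p - q)|) (g := fun q => K * ‖p - q‖)
      h1 (((continuousOn_const.sub hc).sub (by fun_prop)).abs) (by fun_prop) (hmem hq)

/-- A ball is connected; if it misses the frontier, it is covered by the disjoint open sets Ω and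
the complement of its closure, and it meets the first. -/
lemma ball_subset_of_disjoint_frontier {N : ℕ} {Ω : Set (Eu N)} (hΩ : IsOpen Ω) {x : Eu N}
    (hx : x ∈ closure Ω)
    {ρ : ℝ} (hρ : 0 < ρ) (h : ∀ y ∈ frontier Ω, y ∉ Metric.ball x ρ) : Metric.ball x ρ ⊆ Ω := by
  have hpre := (convex_ball x ρ).isPreconnected
  obtain ⟨y, hyb, hyΩ⟩ := mem_closure_iff_nhds.1 hx _ (Metric.ball_mem_nhds x hρ)
  have hcl : ∀ z ∈ Metric.ball x ρ, z ∈ closure Ω → z ∈ Ω := fun z hz hzc => by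
    by_contra hzΩ
    exact h z (by rw [hΩ.frontier_eq]; exact ⟨hzc, hzΩ⟩) hz
  by_contra hns
  obtain ⟨z, hz, hzΩ⟩ := not_subset.1 hns
  obtain ⟨w, -, hw1, hw2⟩ := hpre Ω (closure Ω)ᶜ hΩ isClosed_closure.isOpen_compl
    (fun z hz => (em (z ∈ closure Ω)).imp (hcl z hz) id) ⟨y, hyb, hyΩ⟩
    ⟨z, hz, fun hzc => hzΩ (hcl z hz hzc)⟩
  exact hw2 (subset_closure hw1)

/-- Away from the boundary no condition on the gradient is needed: the whole space is invariant
under every translation. -/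
lemma C1HolderBound.isFlatModel_interior {N : ℕ} {γ M C : ℝ} (hγ : 1 < γ) (hγ2 : γ < 2)
    (hC : 3 ≤ C) {Ω : Set (Eu N)} (hΩ : IsOpen Ω) {u : Eu N → ℝ} (hu : C1HolderBound γ M Ω u)
    {x : Eu N} {r : ℝ} (hr : 0 < r) (hsub : Metric.ball x (3 * r) ⊆ Ω) :
    IsFlatModel γ M C Ω u x r (gradient u x) univ := by
  have hxb : x ∈ Metric.ball x (3 * r) := Metric.mem_ball_self (by positivity)
  have hM : 0 ≤ M := hu.nonneg (subset_closure (hsub hxb))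
  refine ⟨MeasurableSet.univ, by simp, hu.norm_gradient_le x (hsub hxb), ?_, ?_⟩
  · rintro p ⟨-, hp⟩ q ⟨-, hq⟩
    have hpb := Metric.closedBall_subset_ball (x := x) (by linarith : 2 * r < 3 * r) hp
    have hqb := Metric.closedBall_subset_ball (x := x) (by linarith : 2 * r < 3 * r) hq
    have hseg := (convex_ball x (3 * r)).segment_subset hqb hpb
    have key := abs_sub_inner_le_of_gradient (f := u) (a := gradient u x) (p := q) (q := p)
      (η := C * M * r ^ (γ - 1))
      (fun z hz => hu.differentiableOn.differentiableAt (hΩ.mem_nhds (hsub (hseg hz))))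
      (fun z hz => by
        refine (hu.norm_gradient_sub_le z (hsub (hseg hz)) x (hsub hxb)).trans ?_
        have h1 : ‖z - x‖ ≤ 3 * r := (mem_ball_iff_norm.1 (hseg hz)).le
        have h2 : ‖z - x‖ ^ (γ - 1) ≤ C * r ^ (γ - 1) := by
          calc ‖z - x‖ ^ (γ - 1) ≤ (3 * r) ^ (γ - 1) := by gcongr
            _ = 3 ^ (γ - 1) * r ^ (γ - 1) := Real.mul_rpow (by norm_num) hr.le
            _ ≤ C * r ^ (γ - 1) := by
              gcongr
              exact (Real.rpow_le_self_of_one_le (by norm_num) (by linarith)).trans hC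
        calc M * ‖z - x‖ ^ (γ - 1) ≤ M * (C * r ^ (γ - 1)) := by gcongr
          _ = C * M * r ^ (γ - 1) := by ring)
    exact key
  · have : symmDiff Ω univ ∩ Metric.closedBall x (2 * r) = ∅ := by
      rw [eq_empty_iff_forall_notMem]
      rintro y ⟨hy, hyb⟩
      have := hsub (Metric.closedBall_subset_ball (x := x) (by linarith : 2 * r < 3 * r) hyb)
      simp [Set.mem_symmDiff, this] at hy
    rw [this]
    simp only [measureReal_empty]
    positivity

lemma C1HolderBound.exists_isFlatModel_boundary {N : ℕ} (hN : 1 ≤ N) {γ M C L R : ℝ} (hγ : 1 < γ)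
    (hγ2 : γ < 2) (hL : 0 ≤ L) (hR : 0 < R)
    (hC1 : (3 + 2 * L) * ((3 + 2 * L) * 5) ≤ C) (hC2 : 2 * (L * 25) * 10 ^ (N - 1) ≤ C)
    {Ω : Set (Eu N)} (hΩ : IsOpen Ω) {u : Eu N → ℝ} (hu : C1HolderBound γ M Ω u)
    (hν : NeumannZero Ω u) {x₀ : Eu N} (hx₀ : x₀ ∈ frontier Ω) {e n : Eu N} {G : Eu N → ℝ}
    (h : IsDefiningFunction γ Ω x₀ R L e n G) {x : Eu N} {r : ℝ} (hr : 0 < r)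
    (hrR : (3 + 2 * L) * (5 * r) ≤ R) (hx : ‖x - x₀‖ < 3 * r) :
    ∃ a H, IsFlatModel γ M C Ω u x r a H := by
  obtain ⟨a, ha, haM, haH⟩ := hu.exists_limit_gradient hγ hx₀.1
  have hM : 0 ≤ M := (norm_nonneg a).trans haM
  have hn0 : 0 < ‖n‖ := lt_of_lt_of_le one_pos h.one_le_norm
  -- This is where the Neumann condition enters: the limit gradient is orthogonal to n, hence
  -- tangent to the model half-space.
  have han : inner ℝ n a = (0 : ℝ) := by
    have : (𝓝[Ω] x₀).NeBot := mem_closure_iff_nhdsWithin_neBot.1 hx₀.1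
    have h1 := hν x₀ hx₀ _ (h.isOuterUnitNormal hγ hR)
    have h2 := ha.inner (𝕜 := ℝ) (tendsto_const_nhds (x := -(‖n‖⁻¹ • n)))
    have h3 := tendsto_nhds_unique h2 h1
    rw [inner_neg_right, inner_smul_right, neg_eq_zero, mul_eq_zero, inv_eq_zero] at h3
    rw [real_inner_comm]
    exact h3.resolve_left hn0.ne'
  -- The radius 5r is 2r around x plus the distance 3r from x to x₀.
  have hcb : Metric.closedBall x (2 * r) ⊆ Metric.ball x₀ (5 * r) := by
    intro y hy
    rw [mem_closedBall_iff_norm] at hy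
    rw [mem_ball_iff_norm]
    have : y - x₀ = (y - x) + (x - x₀) := by abel
    rw [this]
    exact (norm_add_le _ _).trans_lt (by linarith)
  refine ⟨a, {y | 0 < inner ℝ n (y - x₀)}, ?_, ?_, haM, ?_, ?_⟩
  · exact (isOpen_lt continuous_const (by fun_prop)).measurableSet
  · intro y t
    have : y + t • a - x₀ = (y - x₀) + t • a := by abel
    simp only [mem_ofPred_eq, this, inner_add_right, inner_smul_right, han, mul_zero, add_zero]
  · rintro p ⟨hp, hpb⟩ q ⟨hq, hqb⟩
    refine abs_sub_inner_le_of_mem_closure hu.continuousOn (Metric.isOpen_ball (x := x₀)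
      (ε := 5 * r)) ?_ ⟨hp, hcb hpb⟩ ⟨hq, hcb hqb⟩
    intro p hp q hq
    have key := h.abs_sub_inner_le hL hΩ hu.differentiableOn hrR (a := a)
      (η := M * ((3 + 2 * L) * (5 * r)) ^ (γ - 1)) (fun z hz => by
        refine (haH z hz.1).trans ?_
        have := (mem_ball_iff_norm.1 hz.2).le
        gcongr) hq hp
    refine key.trans (mul_le_mul_of_nonneg_right ?_ (norm_nonneg _))
    have h1 : ((3 + 2 * L) * (5 * r)) ^ (γ - 1) ≤ ((3 + 2 * L) * 5) * r ^ (γ - 1) := by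
      rw [← mul_assoc, Real.mul_rpow (by positivity) hr.le]
      gcongr
      exact Real.rpow_le_self_of_one_le (by nlinarith) (by linarith)
    calc (3 + 2 * L) * (M * ((3 + 2 * L) * (5 * r)) ^ (γ - 1))
        ≤ (3 + 2 * L) * (M * (((3 + 2 * L) * 5) * r ^ (γ - 1))) := by gcongr
      _ = ((3 + 2 * L) * ((3 + 2 * L) * 5)) * M * r ^ (γ - 1) := by ring
      _ ≤ C * M * r ^ (γ - 1) := by gcongr
  -- Where Ω and the half-space disagree, G and its linear part do not have the same strict sign, so
  -- the linear part is at most their difference L(5r)^γ. The disagreement therefore lies in a thin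
  -- slab.
  · have hsub : symmDiff Ω {y | 0 < inner ℝ n (y - x₀)} ∩ Metric.closedBall x (2 * r) ⊆
        {y : Eu N | |inner ℝ n (y - x₀)| ≤ L * (5 * r) ^ γ ∧ ‖y - x₀‖ ≤ 5 * r} := by
      rintro y ⟨hy, hyb⟩
      have hy5 := hcb hyb
      have hyn := (mem_ball_iff_norm.1 hy5).le
      refine ⟨?_, hyn⟩
      have hyR : y ∈ Metric.ball x₀ R :=
        Metric.ball_subset_ball (by nlinarith : 5 * r ≤ R) hy5
      have hab : |G y - inner ℝ n (y - x₀)| ≤ L * (5 * r) ^ γ :=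
        (h.abs_sub_le y).trans (by gcongr)
      rw [_root_.abs_le] at hab ⊢
      rw [Set.mem_symmDiff, h.mem_iff y hyR] at hy
      simp only [mem_ofPred_eq, not_lt] at hy
      rcases hy with hy | hy <;> constructor <;> linarith [hab.1, hab.2]
    have hvol := (measure_mono hsub).trans (volume_slab_le hN h.one_le_norm (x₀ := x₀)
      (t := L * (5 * r) ^ γ) (ρ := 5 * r) (by positivity) (by positivity))
    have hreal := ENNReal.toReal_mono ENNReal.ofReal_ne_top hvol
    rw [ENNReal.toReal_ofReal (by positivity)] at hreal
    refine hreal.trans ?_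
    have h5 : (5 * r) ^ γ ≤ 25 * r ^ γ := by
      rw [Real.mul_rpow (by norm_num) hr.le]
      gcongr
      calc (5 : ℝ) ^ γ ≤ 5 ^ (2 : ℝ) := Real.rpow_le_rpow_of_exponent_le (by norm_num) hγ2.le
        _ = 25 := by norm_num
    have hpow : r ^ γ * r ^ (N - 1) = r ^ ((N : ℝ) - 1 + γ) := by
      rw [← Real.rpow_natCast, Nat.cast_sub hN, ← Real.rpow_add hr]
      congr 1; push_cast; ring
    calc 2 * (L * (5 * r) ^ γ) * (2 * (5 * r)) ^ (N - 1)
        ≤ 2 * (L * (25 * r ^ γ)) * (2 * (5 * r)) ^ (N - 1) := by gcongr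
      _ = 2 * (L * 25) * 10 ^ (N - 1) * (r ^ γ * r ^ (N - 1)) := by
        rw [show 2 * (5 * r) = 10 * r by ring, mul_pow]; ring
      _ ≤ C * r ^ ((N : ℝ) - 1 + γ) := by rw [hpow]; gcongr

lemma HasGraphChart.mono {N : ℕ} {γ : ℝ} {Ω : Set (Eu N)} {x₀ x₁ : Eu N} {R R' : ℝ} {L L' : ℝ≥0}
    (h : HasGraphChart γ Ω x₀ R L) (hsub : Metric.ball x₁ R' ⊆ Metric.ball x₀ R) (hL : L ≤ L') :
    HasGraphChart γ Ω x₁ R' L' := by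
  obtain ⟨e, g, he, hg, hgL, hgH, hmem⟩ := h
  exact ⟨e, g, he, hg, fun z => (hgL z).trans (NNReal.coe_le_coe.2 hL), hgH.mono hL,
    fun y hy => hmem y (hsub hy)⟩

/-- Compactness of the frontier: finitely many half-radius balls cover it, and a chart serves every
frontier point in its half ball with the remaining half radius. -/
lemma IsHolderDomain.hasUniformCharts {N : ℕ} {γ : ℝ} {Ω : Set (Eu N)} (hΩ : IsHolderDomain γ Ω)
    (hb : Bornology.IsBounded Ω) : HasUniformCharts γ Ω := by
  have hcomp : IsCompact (frontier Ω) :=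
    hb.isCompact_closure.of_isClosed_subset isClosed_frontier frontier_subset_closure
  choose! R L hR hchart using hΩ.2
  obtain ⟨t, htf, ht⟩ := hcomp.elim_nhds_subcover (fun x => Metric.ball x (R x / 2))
    (fun x hx => Metric.ball_mem_nhds x (half_pos (hR x hx)))
  have hR0 : ∃ R₀ > 0, ∀ x ∈ t, R₀ ≤ R x / 2 := by
    rcases t.eq_empty_or_nonempty with rfl | hne
    · exact ⟨1, one_pos, by simp⟩
    · refine ⟨t.inf' hne (fun x => R x / 2), ?_, fun x hx => Finset.inf'_le _ hx⟩
      exact (Finset.lt_inf'_iff hne).2 fun x hx => half_pos (hR x (htf x hx))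
  obtain ⟨R₀, hR₀, hRle⟩ := hR0
  refine ⟨R₀, t.sup L, hR₀, fun x₁ hx₁ => ?_⟩
  obtain ⟨x, hx, hxb⟩ := mem_iUnion₂.1 (ht hx₁)
  refine (hchart x (htf x hx)).mono ?_ (Finset.le_sup hx)
  refine Metric.ball_subset_ball' ?_
  have := Metric.mem_ball.1 hxb
  have := hRle x hx
  linarith

/-- Flat models exist at all small scales, uniformly in the point and the function. -/
lemma HasUniformCharts.exists_isFlatModel {N : ℕ} (hN : 1 ≤ N) {γ : ℝ} (hγ : 1 < γ) (hγ2 : γ < 2)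
    {Ω : Set (Eu N)} (hΩ : IsOpen Ω) (hU : HasUniformCharts γ Ω) :
    ∃ r₀ C : ℝ, 0 < r₀ ∧ 0 ≤ C ∧ ∀ u M, C1HolderBound γ M Ω u → NeumannZero Ω u →
      ∀ x ∈ closure Ω, ∀ r, 0 < r → r ≤ r₀ → ∃ a H, IsFlatModel γ M C Ω u x r a H := by
  obtain ⟨R, L, hR, hchart⟩ := hU
  have hL : (0 : ℝ) ≤ L := L.coe_nonneg
  have hpow : (0 : ℝ) ≤ 2 * (L * 25) * 10 ^ (N - 1) := by positivity
  have hsq : (0 : ℝ) ≤ (3 + 2 * L) * ((3 + 2 * L) * 5) := by positivity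
  refine ⟨R / ((3 + 2 * L) * 5), 3 + (3 + 2 * L) * ((3 + 2 * L) * 5) +
    2 * (L * 25) * 10 ^ (N - 1), by positivity, by positivity, ?_⟩
  intro u M hu hν x hx r hr hrr
  -- The alternatives are the whole space as a model when the ball of radius 3r misses the boundary,
  -- and the tangent half-space at a boundary point in that ball otherwise.
  by_cases hcase : ∀ y ∈ frontier Ω, y ∉ Metric.ball x (3 * r)
  · exact ⟨_, _, hu.isFlatModel_interior hγ hγ2 (by linarith) hΩ hr
      (ball_subset_of_disjoint_frontier hΩ hx (by positivity) hcase)⟩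
  · push Not at hcase
    obtain ⟨x₀, hx₀, hx₀b⟩ := hcase
    obtain ⟨e, n, G, hG⟩ := (hchart x₀ hx₀).exists_isDefiningFunction hγ hΩ hx₀ hR
    refine hu.exists_isFlatModel_boundary hN hγ hγ2 hL hR (by linarith) (by linarith) hΩ hν hx₀
      hG hr ?_ ?_
    · rw [le_div_iff₀ (by positivity)] at hrr
      linarith
    · rw [← norm_neg, neg_sub]; exact mem_ball_iff_norm.1 hx₀b

/-! ### Cancellation on flat models -/

/-- Reflection in the hyperplane orthogonal to a moves each point by a multiple of a, so it
preserves H; it preserves |x - y| and changes the sign of the linear factor. The centre x is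
arbitrary and need not be related to H. -/
lemma integral_inner_radial_eq_zero {N : ℕ} {a : Eu N} {H : Set (Eu N)} (hH : MeasurableSet H)
    (hinv : ∀ y, ∀ t : ℝ, y + t • a ∈ H ↔ y ∈ H) (Φ : ℝ → ℝ) (x : Eu N) :
    ∫ y in H, inner ℝ a (x - y) * Φ ‖x - y‖ = 0 := by
  set F : Eu N → ℝ := H.indicator fun y => inner ℝ a (x - y) * Φ ‖x - y‖ with hF
  set σ := (ℝ ∙ a)ᗮ.reflection with hσ
  have hσn : ∀ z, ‖σ z‖ = ‖z‖ := σ.norm_map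
  have hσa : ∀ z, inner ℝ a (σ z) = -(inner ℝ a z : ℝ) := by
    intro z
    have h1 : σ a = -a := Submodule.reflection_orthogonalComplement_singleton_eq_neg a
    have h2 := σ.inner_map_map a z
    rw [h1, inner_neg_left] at h2
    linarith
  have hσt : ∀ z, ∃ t : ℝ, σ z = z + t • a := by
    intro z
    refine ⟨-(2 * (inner ℝ a z / ((‖a‖ : ℝ) ^ 2))), ?_⟩
    rw [hσ, Submodule.reflection_orthogonal_apply, Submodule.reflection_singleton_apply]
    simp only [RCLike.ofReal_real_eq_id, id, two_smul, two_mul]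
    module
  have hodd : ∀ z, F (x - σ z) = -F (x - z) := by
    intro z
    obtain ⟨t, ht⟩ := hσt z
    have hmem : x - σ z ∈ H ↔ x - z ∈ H := by
      rw [← hinv (x - z) (-t), ht, neg_smul, ← sub_eq_add_neg, sub_sub]
    by_cases hz : x - z ∈ H
    · rw [hF, indicator_of_mem hz, indicator_of_mem (hmem.2 hz)]
      simp only [sub_sub_cancel, hσn, hσa]
      ring
    · rw [hF, indicator_of_notMem hz, indicator_of_notMem (fun h => hz (hmem.1 h)), neg_zero]
  have h1 : ∫ z, F (x - σ z) = ∫ z, F (x - z) :=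
    σ.measurePreserving.integral_comp σ.toHomeomorph.measurableEmbedding fun z => F (x - z)
  simp only [hodd, integral_neg] at h1
  have h2 : ∫ z, F (x - z) = 0 := by linarith
  rw [integral_sub_left_eq_self F volume x] at h2
  rw [← integral_indicator hH]
  exact h2

/-- Since the integral over H vanishes, the integral over Ω equals the difference of the two, and
only the symmetric difference contributes. -/
lemma abs_integral_le_of_symmDiff {N : ℕ} {Ω H : Set (Eu N)} (hΩ : MeasurableSet Ω)
    (hH : MeasurableSet H) {l : Eu N → ℝ} (hl : AEStronglyMeasurable l) {x : Eu N} {ρ K : ℝ}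
    (hbound : ∀ y, |l y| ≤ (Metric.closedBall x ρ).indicator (fun _ => K) y)
    (hzero : ∫ y in H, l y = 0) :
    Integrable l ∧
      |∫ y in Ω, l y| ≤ K * volume.real (symmDiff Ω H ∩ Metric.closedBall x ρ) := by
  have hball : volume (Metric.closedBall x ρ) ≠ ⊤ := measure_closedBall_lt_top.ne
  have hint : Integrable l := by
    refine Integrable.mono' (g := (Metric.closedBall x ρ).indicator fun _ => K) ?_ hl
      (Eventually.of_forall hbound)
    exact (integrable_indicator_iff measurableSet_closedBall).2 (integrableOn_const hball)
  refine ⟨hint, ?_⟩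
  have hS : MeasurableSet (symmDiff Ω H ∩ Metric.closedBall x ρ) :=
    (hΩ.symmDiff hH).inter measurableSet_closedBall
  have hSfin : volume (symmDiff Ω H ∩ Metric.closedBall x ρ) ≠ ⊤ :=
    (measure_mono inter_subset_right).trans_lt measure_closedBall_lt_top |>.ne
  have h1 : ∫ y in Ω, l y = ∫ y, (Ω.indicator l y - H.indicator l y) := by
    rw [integral_sub (hint.indicator hΩ) (hint.indicator hH), integral_indicator hΩ,
      integral_indicator hH, hzero, sub_zero]
  rw [h1]
  have h2 := norm_integral_le_of_norm_le (μ := volume)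
    (f := fun y => Ω.indicator l y - H.indicator l y)
    (g := (symmDiff Ω H ∩ Metric.closedBall x ρ).indicator fun _ => K)
    ((integrable_indicator_iff hS).2 (integrableOn_const hSfin))
    (Eventually.of_forall fun y => by
      have hb := hbound y
      by_cases hy : y ∈ Metric.closedBall x ρ
      · rw [indicator_of_mem hy] at hb
        have hK := (abs_nonneg _).trans hb
        by_cases h3 : y ∈ Ω <;> by_cases h4 : y ∈ H <;>
          simp only [indicator, mem_inter_iff, Set.mem_symmDiff, h3, h4, hy] <;> simp <;>
          exact hb
      · rw [indicator_of_notMem hy] at hb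
        have h0 : l y = 0 := abs_eq_zero.1 (le_antisymm hb (abs_nonneg _))
        simp [indicator, h0, hy])
  rw [integral_indicator hS, setIntegral_const, smul_eq_mul, mul_comm] at h2
  exact h2

lemma abs_integral_le_of_near_odd {N : ℕ} {Ω H : Set (Eu N)} (hΩ : MeasurableSet Ω)
    (hH : MeasurableSet H) {f l : Eu N → ℝ} (hf : AEStronglyMeasurable f (volume.restrict Ω))
    (hl : AEStronglyMeasurable l) {x : Eu N} {ρ K₁ K₂ : ℝ}
    (hdiff : ∀ y ∈ Ω, |f y - l y| ≤ (Metric.closedBall x ρ).indicator (fun _ => K₁) y)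
    (hbound : ∀ y, |l y| ≤ (Metric.closedBall x ρ).indicator (fun _ => K₂) y)
    (hK₁ : 0 ≤ K₁) (hzero : ∫ y in H, l y = 0) :
    |∫ y in Ω, f y| ≤ K₁ * volume.real (Metric.closedBall x ρ) +
      K₂ * volume.real (symmDiff Ω H ∩ Metric.closedBall x ρ) := by
  obtain ⟨hlint, hlle⟩ := abs_integral_le_of_symmDiff hΩ hH hl hbound hzero
  have hball : volume (Metric.closedBall x ρ) ≠ ⊤ := measure_closedBall_lt_top.ne
  have hcint : Integrable ((Metric.closedBall x ρ).indicator fun _ => K₁) (volume : Measure (Eu N)) :=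
    (integrable_indicator_iff measurableSet_closedBall).2 (integrableOn_const hball)
  have hae : ∀ᵐ y ∂(volume.restrict Ω), ‖f y - l y‖ ≤
      (Metric.closedBall x ρ).indicator (fun _ => K₁) y :=
    (ae_restrict_iff' hΩ).2 (Eventually.of_forall hdiff)
  have hdint : Integrable (fun y => f y - l y) (volume.restrict Ω) :=
    hcint.integrableOn.mono' (hf.sub hl.restrict) hae
  have h1 : |∫ y in Ω, (f y - l y)| ≤ K₁ * volume.real (Metric.closedBall x ρ) := by
    refine (norm_integral_le_of_norm_le hcint.integrableOn hae).trans ?_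
    refine (setIntegral_le_integral hcint (Eventually.of_forall fun y =>
      indicator_nonneg (fun _ _ => hK₁) y)).trans ?_
    rw [integral_indicator measurableSet_closedBall, setIntegral_const, smul_eq_mul, mul_comm]
  have h2 : ∫ y in Ω, f y = (∫ y in Ω, (f y - l y)) + ∫ y in Ω, l y := by
    rw [← integral_add hdint hlint.integrableOn]; simp
  rw [h2]
  exact (abs_add_le _ _).trans (add_le_add h1 hlle)

lemma volume_real_closedBall_two_mul {N : ℕ} (x : Eu N) {r : ℝ} (hr : 0 < r) :
    volume.real (Metric.closedBall x (2 * r)) =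
      2 ^ N * volume.real (Metric.ball (0 : Eu N) 1) * r ^ (N : ℝ) := by
  rw [Measure.addHaar_real_closedBall _ _ (by positivity), finrank_euclideanSpace_fin, mul_pow,
    Real.rpow_natCast]
  ring

lemma C1HolderBound.aestronglyMeasurable {N : ℕ} {γ M : ℝ} {Ω : Set (Eu N)} {u : Eu N → ℝ}
    (hu : C1HolderBound γ M Ω u) (hΩ : IsOpen Ω) :
    AEStronglyMeasurable u (volume.restrict Ω) :=
  (hu.continuousOn.mono subset_closure).aestronglyMeasurable hΩ.measurableSet

lemma C1HolderBound.aestronglyMeasurable_mul {N : ℕ} {γ M : ℝ} {Ω : Set (Eu N)} {u : Eu N → ℝ}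
    (hu : C1HolderBound γ M Ω u) (hΩ : IsOpen Ω) {Φ : ℝ → ℝ} (hΦ : Measurable Φ) (x : Eu N) :
    AEStronglyMeasurable (fun y => (u x - u y) * Φ ‖x - y‖) (volume.restrict Ω) := by
  have h1 : Measurable fun y : Eu N => Φ ‖x - y‖ := hΦ.comp (by fun_prop)
  exact (aestronglyMeasurable_const.sub (hu.aestronglyMeasurable hΩ)).mul
    h1.aestronglyMeasurable

lemma aestronglyMeasurable_inner_mul {N : ℕ} {Φ : ℝ → ℝ} (hΦ : Measurable Φ) (a x : Eu N) :
    AEStronglyMeasurable (fun y => inner ℝ a (x - y) * Φ ‖x - y‖) := by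
  have h1 : Measurable fun y : Eu N => Φ ‖x - y‖ := hΦ.comp (by fun_prop)
  have h2 : Measurable fun y : Eu N => (inner ℝ a (x - y) : ℝ) := by fun_prop
  exact (h2.mul h1).aestronglyMeasurable

/-- Compare with the linear part ⟨a, x - y⟩ times the kernel. The linearization error M r^γ over a
volume r^N and the linear part M r over a volume r^(N-1+γ) both give M B r^(N+γ). -/
lemma IsFlatModel.abs_integral_le {N : ℕ} {γ M C : ℝ} (hC : 0 ≤ C) {Ω : Set (Eu N)}
    (hΩ : IsOpen Ω) {u : Eu N → ℝ} (hu : C1HolderBound γ M Ω u) {x : Eu N} (hx : x ∈ closure Ω)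
    {r : ℝ} (hr : 0 < r) {a : Eu N} {H : Set (Eu N)} (h : IsFlatModel γ M C Ω u x r a H)
    {Φ : ℝ → ℝ} (hΦ : Measurable Φ) {B : ℝ} (hB : ∀ t, 0 ≤ t → |Φ t| ≤ B)
    (hsupp : ∀ t, r < t → Φ t = 0) :
    |∫ y in Ω, (u x - u y) * Φ ‖x - y‖| ≤
      C * (2 ^ N * volume.real (Metric.ball (0 : Eu N) 1) + 1) * M * B * r ^ (N + γ) := by
  have hM : 0 ≤ M := hu.nonneg hx
  have hB0 : 0 ≤ B := (abs_nonneg _).trans (hB 0 le_rfl)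
  have key := abs_integral_le_of_near_odd (x := x) (ρ := 2 * r) (K₁ := C * M * r ^ (γ - 1) * r * B)
    (K₂ := M * r * B) hΩ.measurableSet h.measurableSet
    (hu.aestronglyMeasurable_mul hΩ hΦ x) (aestronglyMeasurable_inner_mul hΦ a x) ?_ ?_
    (by positivity) (integral_inner_radial_eq_zero h.measurableSet h.add_smul_mem Φ x)
  · refine key.trans ?_
    rw [volume_real_closedBall_two_mul x hr]
    refine (add_le_add_right (mul_le_mul_of_nonneg_left h.volume_le (by positivity)) _).trans
      (le_of_eq ?_)
    have e1 : r ^ ((N : ℝ) + γ) = r ^ (γ - 1) * r * r ^ (N : ℝ) := by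
      rw [← Real.rpow_add_one hr.ne', ← Real.rpow_add hr]; congr 1; ring
    have e2 : r ^ ((N : ℝ) + γ) = r * r ^ ((N : ℝ) - 1 + γ) := by
      rw [mul_comm, ← Real.rpow_add_one hr.ne']; congr 1; ring
    calc _ = C * M * B * (2 ^ N * volume.real (Metric.ball (0 : Eu N) 1)) *
          (r ^ (γ - 1) * r * r ^ (N : ℝ)) + C * M * B * (r * r ^ ((N : ℝ) - 1 + γ)) := by ring
      _ = _ := by rw [← e1, ← e2]; ring
  · intro y hy
    rw [← sub_mul, abs_mul]
    rcases le_or_gt ‖x - y‖ r with hle | hgt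
    · have hyb : y ∈ Metric.closedBall x (2 * r) := by
        rw [mem_closedBall_iff_norm, ← norm_neg, neg_sub]; linarith
      rw [indicator_of_mem hyb]
      have h1 := h.abs_sub_inner_le x ⟨hx, Metric.mem_closedBall_self (by positivity)⟩ y
        ⟨subset_closure hy, hyb⟩
      have h2 : C * M * r ^ (γ - 1) * ‖x - y‖ ≤ C * M * r ^ (γ - 1) * r := by gcongr
      exact mul_le_mul (h1.trans h2) (hB _ (norm_nonneg _)) (abs_nonneg _) (by positivity)
    · rw [hsupp _ hgt, abs_zero, mul_zero]
      exact indicator_nonneg (fun _ _ => by positivity) y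
  · intro y
    rw [abs_mul]
    rcases le_or_gt ‖x - y‖ r with hle | hgt
    · have hyb : y ∈ Metric.closedBall x (2 * r) := by
        rw [mem_closedBall_iff_norm, ← norm_neg, neg_sub]; linarith
      rw [indicator_of_mem hyb]
      have h1 := (abs_real_inner_le_norm a (x - y)).trans
        (mul_le_mul h.norm_le hle (norm_nonneg _) hM)
      exact mul_le_mul h1 (hB _ (norm_nonneg _)) (abs_nonneg _) (by positivity)
    · rw [hsupp _ hgt, abs_zero, mul_zero]
      exact indicator_nonneg (fun _ _ => by positivity) y

/-- One model, built at x, serves both points, as the linear integral over H vanishes around either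
centre. The ball of radius 2r contains the supports of both kernels. A difference falls either on
the prefactor or on the kernel, each time giving |x - z|/r. -/
lemma IsFlatModel.abs_integral_sub_le {N : ℕ} {γ M C : ℝ} (hC : 0 ≤ C) {Ω : Set (Eu N)}
    (hΩ : IsOpen Ω) {u : Eu N → ℝ} (hu : C1HolderBound γ M Ω u) {x z : Eu N}
    (hx : x ∈ closure Ω) (hz : z ∈ closure Ω)
    {r : ℝ} (hr : 0 < r) (hxz : ‖x - z‖ ≤ r) {a : Eu N} {H : Set (Eu N)}
    (h : IsFlatModel γ M C Ω u x r a H)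
    {Φ : ℝ → ℝ} (hΦ : Measurable Φ) {B : ℝ} (hB : ∀ t, 0 ≤ t → |Φ t| ≤ B)
    (hlip : ∀ t t', 0 ≤ t → 0 ≤ t' → |Φ t - Φ t'| ≤ B / r * |t - t'|)
    (hsupp : ∀ t, r < t → Φ t = 0) :
    |∫ y in Ω, ((u x - u y) * Φ ‖x - y‖ - (u z - u y) * Φ ‖z - y‖)| ≤
      4 * (C * (2 ^ N * volume.real (Metric.ball (0 : Eu N) 1) + 1)) * M * B * ‖x - z‖ *
        r ^ (N - 1 + γ) := by
  have hM : 0 ≤ M := hu.nonneg hx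
  have hB0 : 0 ≤ B := (abs_nonneg _).trans (hB 0 le_rfl)
  have hxm : x ∈ closure Ω ∩ Metric.closedBall x (2 * r) :=
    ⟨hx, Metric.mem_closedBall_self (by positivity)⟩
  have hzm : z ∈ closure Ω ∩ Metric.closedBall x (2 * r) := by
    refine ⟨hz, ?_⟩
    rw [mem_closedBall_iff_norm, ← norm_neg, neg_sub]; linarith
  have hΦd : ∀ y, |Φ ‖x - y‖ - Φ ‖z - y‖| ≤ B / r * ‖x - z‖ := fun y => by
    refine (hlip _ _ (norm_nonneg _) (norm_nonneg _)).trans ?_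
    gcongr
    simpa using abs_norm_sub_norm_le (x - y) (z - y)
  have hzy : ∀ y, ‖x - y‖ ≤ 2 * r → ‖z - y‖ ≤ 3 * r := fun y hy => by
    have : z - y = (x - y) - (x - z) := by abel
    rw [this]; exact (norm_sub_le _ _).trans (by linarith)
  have hfar : ∀ y, 2 * r < ‖x - y‖ → Φ ‖x - y‖ = 0 ∧ Φ ‖z - y‖ = 0 := fun y hy => by
    refine ⟨hsupp _ (by linarith), hsupp _ ?_⟩
    have : x - y = (x - z) + (z - y) := by abel
    rw [this] at hy
    have := norm_add_le (x - z) (z - y)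
    linarith
  have hmemb : ∀ y, ‖x - y‖ ≤ 2 * r → y ∈ Metric.closedBall x (2 * r) := fun y hy => by
    rw [mem_closedBall_iff_norm, ← norm_neg, neg_sub]; exact hy
  have hl := aestronglyMeasurable_inner_mul hΦ a
  have key := abs_integral_le_of_near_odd (x := x) (ρ := 2 * r)
    (f := fun y => (u x - u y) * Φ ‖x - y‖ - (u z - u y) * Φ ‖z - y‖)
    (l := fun y => inner ℝ a (x - y) * Φ ‖x - y‖ - inner ℝ a (z - y) * Φ ‖z - y‖)
    (K₁ := C * M * r ^ (γ - 1) * 4 * B * ‖x - z‖)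
    (K₂ := M * 4 * B * ‖x - z‖) hΩ.measurableSet h.measurableSet
    ((hu.aestronglyMeasurable_mul hΩ hΦ x).sub (hu.aestronglyMeasurable_mul hΩ hΦ z))
    ((hl x).sub (hl z)) ?_ ?_ (by positivity) ?_
  · refine key.trans ?_
    rw [volume_real_closedBall_two_mul x hr]
    refine (add_le_add_right (mul_le_mul_of_nonneg_left h.volume_le (by positivity)) _).trans
      (le_of_eq ?_)
    have e1 : r ^ ((N : ℝ) - 1 + γ) = r ^ (γ - 1) * r ^ (N : ℝ) := by
      rw [← Real.rpow_add hr]; congr 1; ring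
    rw [e1]; ring
  · intro y hy
    rcases le_or_gt ‖x - y‖ (2 * r) with hle | hgt
    · rw [indicator_of_mem (hmemb y hle)]
      have h1 := h.abs_sub_inner_le x hxm z hzm
      have h2 := h.abs_sub_inner_le z hzm y ⟨subset_closure hy, hmemb y hle⟩
      -- After this splitting, the affine error is taken once between x and z and once between z and
      -- y. With |z - y| ≤ 3r and kernel Lipschitz constant B/r, the two terms add up to the factor
      -- 4 = 1 + 3.
      have e : (u x - u y) * Φ ‖x - y‖ - (u z - u y) * Φ ‖z - y‖ -
          (inner ℝ a (x - y) * Φ ‖x - y‖ - inner ℝ a (z - y) * Φ ‖z - y‖) =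
          (u x - u z - inner ℝ a (x - z)) * Φ ‖x - y‖ +
            (u z - u y - inner ℝ a (z - y)) * (Φ ‖x - y‖ - Φ ‖z - y‖) := by
        simp only [inner_sub_right]; ring
      rw [e]
      refine (abs_add_le _ _).trans ?_
      rw [abs_mul, abs_mul]
      have h3 : C * M * r ^ (γ - 1) * ‖z - y‖ ≤ C * M * r ^ (γ - 1) * (3 * r) := by
        gcongr; exact hzy y hle
      refine (add_le_add (mul_le_mul h1 (hB _ (norm_nonneg _)) (abs_nonneg _) (by positivity))
        (mul_le_mul (h2.trans h3) (hΦd y) (abs_nonneg _) (by positivity))).trans (le_of_eq ?_)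
      field_simp
      ring
    · obtain ⟨h1, h2⟩ := hfar y hgt
      rw [h1, h2]
      simp only [mul_zero, sub_self, abs_zero]
      exact indicator_nonneg (fun _ _ => by positivity) y
  · intro y
    rcases le_or_gt ‖x - y‖ (2 * r) with hle | hgt
    · rw [indicator_of_mem (hmemb y hle)]
      have e : (inner ℝ a (x - y) * Φ ‖x - y‖ - inner ℝ a (z - y) * Φ ‖z - y‖ : ℝ) =
          inner ℝ a (x - z) * Φ ‖x - y‖ + inner ℝ a (z - y) * (Φ ‖x - y‖ - Φ ‖z - y‖) := by
        simp only [inner_sub_right]; ring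
      rw [e]
      refine (abs_add_le _ _).trans ?_
      rw [abs_mul, abs_mul]
      have h1 : |(inner ℝ a (x - z) : ℝ)| ≤ M * ‖x - z‖ :=
        (abs_real_inner_le_norm _ _).trans (by gcongr; exact h.norm_le)
      have h2 : |(inner ℝ a (z - y) : ℝ)| ≤ M * (3 * r) :=
        (abs_real_inner_le_norm _ _).trans
          (mul_le_mul h.norm_le (hzy y hle) (norm_nonneg _) hM)
      refine (add_le_add (mul_le_mul h1 (hB _ (norm_nonneg _)) (abs_nonneg _) (by positivity))
        (mul_le_mul h2 (hΦd y) (abs_nonneg _) (by positivity))).trans (le_of_eq ?_)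
      field_simp
      ring
    · obtain ⟨h1, h2⟩ := hfar y hgt
      rw [h1, h2]
      simp only [mul_zero, sub_self, abs_zero]
      exact indicator_nonneg (fun _ _ => by positivity) y
  · have hint : ∀ w, Integrable fun y => inner ℝ a (w - y) * Φ ‖w - y‖ := fun w => by
      refine (abs_integral_le_of_symmDiff (x := w) (ρ := r) (K := M * r * B) hΩ.measurableSet
        h.measurableSet (hl w) (fun y => ?_)
        (integral_inner_radial_eq_zero h.measurableSet h.add_smul_mem Φ w)).1
      rw [abs_mul]
      rcases le_or_gt ‖w - y‖ r with hle | hgt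
      · have hyb : y ∈ Metric.closedBall w r := by
          rw [mem_closedBall_iff_norm, ← norm_neg, neg_sub]; exact hle
        rw [indicator_of_mem hyb]
        have h1 := (abs_real_inner_le_norm a (w - y)).trans
          (mul_le_mul h.norm_le hle (norm_nonneg _) hM)
        exact mul_le_mul h1 (hB _ (norm_nonneg _)) (abs_nonneg _) (by positivity)
      · rw [hsupp _ hgt, abs_zero, mul_zero]
        exact indicator_nonneg (fun _ _ => by positivity) y
    rw [integral_sub (hint x).integrableOn (hint z).integrableOn,
      integral_inner_radial_eq_zero h.measurableSet h.add_smul_mem,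
      integral_inner_radial_eq_zero h.measurableSet h.add_smul_mem, sub_zero]

/-! ### Capped and truncated kernels -/

lemma abs_rpow_neg_sub_le {a b m p : ℝ} (hm : 0 < m) (hp : 0 ≤ p) (ha : m ≤ a) (hb : m ≤ b) :
    |a ^ (-p) - b ^ (-p)| ≤ p * m ^ (-p - 1) * |a - b| := by
  have key := (convex_Ici m).norm_image_sub_le_of_norm_hasDerivWithin_le
    (f := fun t : ℝ => t ^ (-p)) (f' := fun t : ℝ => -p * t ^ (-p - 1))
    (C := p * m ^ (-p - 1))
    (fun t ht => (Real.hasDerivAt_rpow_const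
      (Or.inl (lt_of_lt_of_le hm ht).ne')).hasDerivWithinAt)
    (fun t ht => by
      have ht0 : 0 < t := lt_of_lt_of_le hm ht
      rw [norm_mul, norm_neg, Real.norm_of_nonneg hp,
        Real.norm_of_nonneg (Real.rpow_nonneg ht0.le _)]
      exact mul_le_mul_of_nonneg_left
        (Real.rpow_le_rpow_of_nonpos hm ht (by linarith)) hp)
    hb ha
  exact key

lemma half_rpow_neg {r : ℝ} (hr : 0 < r) (p : ℝ) : (r / 2) ^ (-p) = 2 ^ p * r ^ (-p) := by
  rw [Real.div_rpow hr.le (by norm_num), Real.rpow_neg (by norm_num : (0 : ℝ) ≤ 2), div_inv_eq_mul,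
    mul_comm]

/-- The bound keeps the decaying factor of the kernel at t, which makes it integrable over the whole
space. It works because moving by at most ρ leaves the capped distance at least half as large. -/
lemma abs_max_rpow_neg_sub_le {t t' ρ p : ℝ} (hρ : 0 < ρ) (hp : 0 ≤ p) (htt : |t - t'| ≤ ρ) :
    |max t ρ ^ (-p) - max t' ρ ^ (-p)| ≤ p * 2 ^ (p + 1) / ρ * |t - t'| * max t ρ ^ (-p) := by
  set m := max t ρ with hm
  have hmρ : ρ ≤ m := le_max_right _ _
  have hm0 : 0 < m := lt_of_lt_of_le hρ hmρ
  have hmm : |m - max t' ρ| ≤ |t - t'| := by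
    simpa using abs_max_sub_max_le_abs t t' ρ
  have hm' : m / 2 ≤ max t' ρ := by
    have h1 : ρ ≤ max t' ρ := le_max_right _ _
    have h2 := (abs_le.1 (hmm.trans htt)).2
    linarith
  have h1 := abs_rpow_neg_sub_le (half_pos hm0) hp (by linarith : m / 2 ≤ m) hm'
  refine h1.trans ?_
  rw [show -p - 1 = -(p + 1) by ring, half_rpow_neg hm0]
  have h3 : m ^ (-(p + 1)) ≤ m ^ (-p) / ρ := by
    rw [show -(p + 1) = -p - 1 by ring, Real.rpow_sub_one hm0.ne']
    gcongr
  calc p * (2 ^ (p + 1) * m ^ (-(p + 1))) * |m - max t' ρ|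
      ≤ p * (2 ^ (p + 1) * (m ^ (-p) / ρ)) * |t - t'| := by gcongr
    _ = _ := by ring

lemma integrable_max_norm_rpow_neg {N : ℕ} {ρ p : ℝ} (hρ : 0 < ρ) (hp : (N : ℝ) < p) :
    Integrable fun y : Eu N => max ‖y‖ ρ ^ (-p) := by
  have hp0 : 0 < p := lt_of_le_of_lt N.cast_nonneg hp
  have h1 : Integrable fun y : Eu N => (1 + ‖y‖) ^ (-p) :=
    integrable_one_add_norm (by rwa [finrank_euclideanSpace_fin])
  set c := ρ / (1 + ρ) with hc
  have hc0 : 0 < c := by positivity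
  refine (h1.const_mul (c ^ (-p))).mono' ?_ (Eventually.of_forall fun y => ?_)
  · exact (by fun_prop : Measurable fun y : Eu N => max ‖y‖ ρ ^ (-p)).aestronglyMeasurable
  · rw [Real.norm_of_nonneg (Real.rpow_nonneg (le_max_of_le_right hρ.le) _),
      ← Real.mul_rpow hc0.le (by positivity)]
    refine Real.rpow_le_rpow_of_nonpos (by positivity) ?_ (by linarith)
    rw [hc, div_mul_eq_mul_div, div_le_iff₀ (by positivity)]
    nlinarith [le_max_left ‖y‖ ρ, le_max_right ‖y‖ ρ, norm_nonneg y]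

lemma integrable_max_norm_sub_rpow_neg {N : ℕ} {ρ p : ℝ} (hρ : 0 < ρ) (hp : (N : ℝ) < p)
    (x : Eu N) : Integrable fun y : Eu N => max ‖x - y‖ ρ ^ (-p) :=
  (integrable_max_norm_rpow_neg hρ hp).comp_sub_left x

lemma setIntegral_max_norm_sub_rpow_neg_le {N : ℕ} {ρ p : ℝ} (hρ : 0 < ρ) (hp : (N : ℝ) < p)
    (x : Eu N) (Ω : Set (Eu N)) :
    ∫ y in Ω, max ‖x - y‖ ρ ^ (-p) ≤ ∫ y : Eu N, max ‖y‖ ρ ^ (-p) := by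
  refine (setIntegral_le_integral (integrable_max_norm_sub_rpow_neg hρ hp x)
    (Eventually.of_forall fun y => Real.rpow_nonneg (le_max_of_le_right hρ.le) _)).trans
    (le_of_eq ?_)
  exact integral_sub_left_eq_self (fun y : Eu N => max ‖y‖ ρ ^ (-p)) volume x

/-- The regional operator whose kernel `‖x - y‖ ^ (-p)` is made constant for `‖x - y‖ ≤ ρ`. -/
noncomputable def cappedOp {N : ℕ} (Ω : Set (Eu N)) (u : Eu N → ℝ) (p ρ : ℝ) (x : Eu N) : ℝ :=
  ∫ y in Ω, (u x - u y) * max ‖x - y‖ ρ ^ (-p)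

lemma measurable_max_rpow (ρ p : ℝ) : Measurable fun t : ℝ => max t ρ ^ p := by fun_prop

lemma C1HolderBound.integrableOn_cappedOp {N : ℕ} {γ M : ℝ} {Ω : Set (Eu N)} (hΩ : IsOpen Ω)
    {u : Eu N → ℝ} (hu : C1HolderBound γ M Ω u) {ρ p : ℝ} (hρ : 0 < ρ) (hp : (N : ℝ) < p)
    {x : Eu N} (hx : x ∈ closure Ω) :
    IntegrableOn (fun y => (u x - u y) * max ‖x - y‖ ρ ^ (-p)) Ω := by
  refine ((integrable_max_norm_sub_rpow_neg hρ hp x).integrableOn.const_mul (2 * M)).mono'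
    (hu.aestronglyMeasurable_mul hΩ (measurable_max_rpow ρ (-p)) x) ?_
  refine (ae_restrict_iff' hΩ.measurableSet).2 (Eventually.of_forall fun y hy => ?_)
  rw [norm_mul, Real.norm_of_nonneg (Real.rpow_nonneg (le_max_of_le_right hρ.le) _)]
  have h1 := hu.abs_le x hx
  have h2 := hu.abs_le y (subset_closure hy)
  gcongr
  exact (abs_sub _ _).trans (by linarith)

lemma C1HolderBound.abs_cappedOp_le {N : ℕ} {γ M : ℝ} {Ω : Set (Eu N)} (hΩ : IsOpen Ω)
    {u : Eu N → ℝ} (hu : C1HolderBound γ M Ω u) {ρ p : ℝ} (hρ : 0 < ρ) (hp : (N : ℝ) < p)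
    {x : Eu N} (hx : x ∈ closure Ω) :
    |cappedOp Ω u p ρ x| ≤ 2 * M * ∫ y : Eu N, max ‖y‖ ρ ^ (-p) := by
  have hM := hu.nonneg hx
  have h := norm_integral_le_of_norm_le (μ := volume.restrict Ω)
    (f := fun y => (u x - u y) * max ‖x - y‖ ρ ^ (-p))
    ((integrable_max_norm_sub_rpow_neg hρ hp x).integrableOn.const_mul (2 * M))
    ((ae_restrict_iff' hΩ.measurableSet).2 (Eventually.of_forall fun y hy => by
      rw [norm_mul, Real.norm_of_nonneg (Real.rpow_nonneg (le_max_of_le_right hρ.le) _)]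
      have h1 := hu.abs_le x hx
      have h2 := hu.abs_le y (subset_closure hy)
      gcongr
      exact (abs_sub _ _).trans (by linarith)))
  refine h.trans ?_
  rw [integral_const_mul]
  gcongr
  exact setIntegral_max_norm_sub_rpow_neg_le hρ hp x Ω

/-- At a fixed cap no cancellation is needed: the integrable tail of the kernel, with its Lipschitz
dependence on the centre, suffices. This starts the dyadic scheme. -/
lemma C1HolderBound.abs_cappedOp_sub_le {N : ℕ} {γ M : ℝ} {Ω : Set (Eu N)} (hΩ : IsOpen Ω)
    {u : Eu N → ℝ} (hu : C1HolderBound γ M Ω u) {ρ p : ℝ} (hρ : 0 < ρ) (hp : (N : ℝ) < p)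
    {x z : Eu N} (hx : x ∈ closure Ω) (hz : z ∈ closure Ω) (hxz : ‖x - z‖ ≤ ρ) {K : ℝ}
    (hK : |u x - u z| ≤ K * M * ‖x - z‖) :
    |cappedOp Ω u p ρ x - cappedOp Ω u p ρ z| ≤
      (K + 2 * (p * 2 ^ (p + 1) / ρ)) * M * ‖x - z‖ * ∫ y : Eu N, max ‖y‖ ρ ^ (-p) := by
  have hM := hu.nonneg hx
  have hp0 : 0 < p := lt_of_le_of_lt N.cast_nonneg hp
  have hcoef : 0 ≤ (K + 2 * (p * 2 ^ (p + 1) / ρ)) * M * ‖x - z‖ := by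
    have := (abs_nonneg _).trans hK
    have h2 : 0 ≤ 2 * (p * 2 ^ (p + 1) / ρ) * M * ‖x - z‖ := by positivity
    linarith
  unfold cappedOp
  rw [← integral_sub (hu.integrableOn_cappedOp hΩ hρ hp hx) (hu.integrableOn_cappedOp hΩ hρ hp hz)]
  refine (norm_integral_le_of_norm_le (μ := volume.restrict Ω)
    (f := fun y => (u x - u y) * max ‖x - y‖ ρ ^ (-p) - (u z - u y) * max ‖z - y‖ ρ ^ (-p))
    ((integrable_max_norm_sub_rpow_neg hρ hp x).integrableOn.const_mul
      ((K + 2 * (p * 2 ^ (p + 1) / ρ)) * M * ‖x - z‖))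
    ((ae_restrict_iff' hΩ.measurableSet).2 (Eventually.of_forall fun y hy => ?_))).trans ?_
  · have e : (u x - u y) * max ‖x - y‖ ρ ^ (-p) - (u z - u y) * max ‖z - y‖ ρ ^ (-p) =
        (u x - u z) * max ‖x - y‖ ρ ^ (-p) +
          (u z - u y) * (max ‖x - y‖ ρ ^ (-p) - max ‖z - y‖ ρ ^ (-p)) := by ring
    have hk0 : 0 ≤ max ‖x - y‖ ρ ^ (-p) := Real.rpow_nonneg (le_max_of_le_right hρ.le) _
    have hd : |‖x - y‖ - ‖z - y‖| ≤ ‖x - z‖ := by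
      simpa using abs_norm_sub_norm_le (x - y) (z - y)
    have h1 := abs_max_rpow_neg_sub_le hρ hp0.le (hd.trans hxz)
    have h2 : |u z - u y| ≤ 2 * M := (abs_sub _ _).trans (by
      linarith [hu.abs_le z hz, hu.abs_le y (subset_closure hy)])
    have h3 : |max ‖x - y‖ ρ ^ (-p) - max ‖z - y‖ ρ ^ (-p)| ≤
        p * 2 ^ (p + 1) / ρ * ‖x - z‖ * max ‖x - y‖ ρ ^ (-p) := h1.trans (by gcongr)
    rw [e, Real.norm_eq_abs]
    refine (abs_add_le _ _).trans ?_
    rw [abs_mul, abs_mul, abs_of_nonneg hk0]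
    refine (add_le_add (mul_le_mul_of_nonneg_right hK hk0)
      (mul_le_mul h2 h3 (abs_nonneg _) (by positivity))).trans (le_of_eq ?_)
    ring
  · rw [integral_const_mul]
    gcongr
    exact setIntegral_max_norm_sub_rpow_neg_le hρ hp x Ω

lemma abs_sub_le_of_mem_Icc {a b c : ℝ} (ha : a ∈ Icc 0 c) (hb : b ∈ Icc 0 c) : |a - b| ≤ c := by
  rw [abs_le]; constructor <;> linarith [ha.1, ha.2, hb.1, hb.2]

/-- The natural constant is 2^p; it is enlarged so that the same B = (p + 1) 2^(p+2) r^(-p) bounds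
the kernel increments and B/r bounds their Lipschitz constants. -/
lemma rpow_neg_mem_Icc {t r p : ℝ} (hr : 0 < r) (hp : 0 ≤ p) (ht : r / 2 ≤ t) :
    t ^ (-p) ∈ Icc 0 ((p + 1) * 2 ^ (p + 2) * r ^ (-p)) := by
  have ht0 : 0 < t := lt_of_lt_of_le (half_pos hr) ht
  refine ⟨Real.rpow_nonneg ht0.le _, ?_⟩
  have h1 := Real.rpow_le_rpow_of_nonpos (half_pos hr) ht (by linarith : -p ≤ 0)
  rw [half_rpow_neg hr] at h1
  refine h1.trans ?_
  gcongr
  have h2 : (2 : ℝ) ^ p ≤ 2 ^ (p + 2) :=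
    Real.rpow_le_rpow_of_exponent_le (by norm_num) (by linarith)
  have h3 : (0 : ℝ) ≤ 2 ^ (p + 2) := by positivity
  nlinarith

lemma abs_capped_kernel_sub_le {r p : ℝ} (hr : 0 < r) (hp : 0 ≤ p) (t : ℝ) :
    |max t (r / 2) ^ (-p) - max t r ^ (-p)| ≤ (p + 1) * 2 ^ (p + 2) * r ^ (-p) :=
  abs_sub_le_of_mem_Icc (rpow_neg_mem_Icc hr hp (le_max_right _ _))
    (rpow_neg_mem_Icc hr hp (by linarith [le_max_right t r]))

lemma abs_capped_kernel_sub_sub_le {r p : ℝ} (hr : 0 < r) (hp : 0 ≤ p) (t t' : ℝ) :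
    |(max t (r / 2) ^ (-p) - max t r ^ (-p)) - (max t' (r / 2) ^ (-p) - max t' r ^ (-p))| ≤
      (p + 1) * 2 ^ (p + 2) * r ^ (-p) / r * |t - t'| := by
  have hm : 0 < r / 2 := half_pos hr
  have h1 := abs_rpow_neg_sub_le hm hp (le_max_right t (r / 2)) (le_max_right t' (r / 2))
  have h2 := abs_rpow_neg_sub_le hm hp (by linarith [le_max_right t r] : r / 2 ≤ max t r)
    (by linarith [le_max_right t' r] : r / 2 ≤ max t' r)
  have e : (max t (r / 2) ^ (-p) - max t r ^ (-p)) - (max t' (r / 2) ^ (-p) - max t' r ^ (-p)) =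
      (max t (r / 2) ^ (-p) - max t' (r / 2) ^ (-p)) - (max t r ^ (-p) - max t' r ^ (-p)) := by ring
  rw [e]
  refine (abs_sub _ _).trans ((add_le_add h1 h2).trans ?_)
  have h3 : |max t (r / 2) - max t' (r / 2)| ≤ |t - t'| := by
    simpa using abs_max_sub_max_le_abs t t' (r / 2)
  have h4 : |max t r - max t' r| ≤ |t - t'| := by
    simpa using abs_max_sub_max_le_abs t t' r
  have h5 : (r / 2) ^ (-p - 1) = 2 ^ (p + 1) * (r ^ (-p) / r) := by
    rw [show -p - 1 = -(p + 1) by ring, half_rpow_neg hr, show -(p + 1) = -p - 1 by ring,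
      Real.rpow_sub_one hr.ne']
  have h6 : (2 : ℝ) ^ (p + 2) = 2 * 2 ^ (p + 1) := by
    rw [show p + 2 = (p + 1) + 1 by ring, Real.rpow_add_one (by norm_num)]; ring
  rw [h5, h6]
  calc p * (2 ^ (p + 1) * (r ^ (-p) / r)) * |max t (r / 2) - max t' (r / 2)| +
        p * (2 ^ (p + 1) * (r ^ (-p) / r)) * |max t r - max t' r|
      ≤ p * (2 ^ (p + 1) * (r ^ (-p) / r)) * |t - t'| +
        p * (2 ^ (p + 1) * (r ^ (-p) / r)) * |t - t'| := by gcongr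
    _ = p * (2 * 2 ^ (p + 1)) * r ^ (-p) / r * |t - t'| := by ring
    _ ≤ (p + 1) * (2 * 2 ^ (p + 1)) * r ^ (-p) / r * |t - t'| := by gcongr; linarith

/-- The radial profile of the kernel of the truncated operator. -/
noncomputable def truncKernel (p ε t : ℝ) : ℝ := (Ici ε).indicator (fun t => t ^ (-p)) t

lemma measurable_truncKernel (p ε : ℝ) : Measurable (truncKernel p ε) :=
  (by fun_prop : Measurable fun t : ℝ => t ^ (-p)).indicator measurableSet_Ici

lemma abs_truncKernel_sub_le {r p ε : ℝ} (hr : 0 < r) (hp : 0 ≤ p) (hε : r / 2 ≤ ε) (t : ℝ) :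
    |truncKernel p ε t - max t r ^ (-p)| ≤ (p + 1) * 2 ^ (p + 2) * r ^ (-p) := by
  refine abs_sub_le_of_mem_Icc ?_ (rpow_neg_mem_Icc hr hp (by linarith [le_max_right t r]))
  unfold truncKernel
  by_cases ht : t ∈ Ici ε
  · rw [indicator_of_mem ht]
    exact rpow_neg_mem_Icc hr hp (hε.trans ht)
  · rw [indicator_of_notMem ht]
    exact ⟨le_rfl, by positivity⟩

lemma setIntegral_integrand_eq {N : ℕ} (s : ℝ) (Ω : Set (Eu N)) (u : Eu N → ℝ) (x : Eu N) (ε : ℝ) :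
    ∫ y in Ω \ Metric.ball x ε, integrand s u x y =
      ∫ y in Ω, (u x - u y) * truncKernel (N + 2 * s) ε ‖x - y‖ := by
  rw [sdiff_eq, ← setIntegral_indicator Metric.isOpen_ball.measurableSet.compl]
  congr 1
  ext y
  have hiff : y ∈ (Metric.ball x ε)ᶜ ↔ ‖x - y‖ ∈ Ici ε := by
    rw [mem_compl_iff, mem_ball_iff_norm, not_lt, mem_Ici, ← norm_neg, neg_sub]
  unfold truncKernel
  by_cases hy : y ∈ (Metric.ball x ε)ᶜ
  · rw [indicator_of_mem hy, indicator_of_mem (hiff.1 hy), integrand,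
      Real.rpow_neg (norm_nonneg _), div_eq_mul_inv]
  · rw [indicator_of_notMem hy, indicator_of_notMem (fun h => hy (hiff.2 h)), mul_zero]

lemma C1HolderBound.integrableOn_integrand {N : ℕ} {γ M s : ℝ} {Ω : Set (Eu N)} (hΩ : IsOpen Ω)
    {u : Eu N → ℝ} (hu : C1HolderBound γ M Ω u) (hs : 0 < s) {x : Eu N} (hx : x ∈ closure Ω)
    {ε : ℝ} (hε : 0 < ε) : IntegrableOn (integrand s u x) (Ω \ Metric.ball x ε) := by
  have h1 := (hu.integrableOn_cappedOp hΩ hε (by linarith : (N : ℝ) < N + 2 * s) hx).mono_set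
    (sdiff_subset (t := Metric.ball x ε))
  refine h1.congr_fun (fun y hy => ?_) (hΩ.measurableSet.diff Metric.isOpen_ball.measurableSet)
  have hle : ε ≤ ‖x - y‖ := by
    have := hy.2
    rwa [mem_ball_iff_norm, not_lt, ← norm_neg, neg_sub] at this
  beta_reduce
  rw [max_eq_left hle, integrand, Real.rpow_neg (norm_nonneg _), div_eq_mul_inv]

lemma C1HolderBound.integrableOn_truncKernel {N : ℕ} {γ M p ε : ℝ} {Ω : Set (Eu N)}
    (hΩ : IsOpen Ω) {u : Eu N → ℝ} (hu : C1HolderBound γ M Ω u) (hp : (N : ℝ) < p) {x : Eu N}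
    (hx : x ∈ closure Ω) (hε : 0 < ε) :
    IntegrableOn (fun y => (u x - u y) * truncKernel p ε ‖x - y‖) Ω := by
  refine Integrable.mono (hu.integrableOn_cappedOp hΩ hε hp hx)
    (hu.aestronglyMeasurable_mul hΩ (measurable_truncKernel p ε) x)
    (Eventually.of_forall fun y => ?_)
  rw [norm_mul, norm_mul]
  gcongr
  unfold truncKernel
  by_cases hy : ‖x - y‖ ∈ Ici ε
  · rw [indicator_of_mem hy, max_eq_left hy]
  · rw [indicator_of_notMem hy, norm_zero]; exact norm_nonneg _

/-! ### Dyadic sequences with Hölder limits -/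

lemma exists_dyadic_scale {r₀ t : ℝ} (hr₀ : 0 < r₀) (ht : 0 < t) (htr : t ≤ r₀) :
    ∃ n : ℕ, r₀ / 2 ^ (n + 1) < t ∧ t ≤ r₀ / 2 ^ n := by
  obtain ⟨n, h1, h2⟩ := exists_nat_pow_near_of_lt_one (x := t / r₀) (y := 1 / 2) (by positivity)
    ((div_le_one hr₀).2 htr) (by norm_num) (by norm_num)
  refine ⟨n, ?_, ?_⟩
  · rw [lt_div_iff₀ hr₀] at h1
    calc r₀ / 2 ^ (n + 1) = (1 / 2) ^ (n + 1) * r₀ := by rw [one_div, inv_pow]; ring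
      _ < t := h1
  · rw [div_le_iff₀ hr₀] at h2
    calc t ≤ (1 / 2) ^ n * r₀ := h2
      _ = r₀ / 2 ^ n := by rw [one_div, inv_pow]; ring

lemma dyadic_rpow {r₀ : ℝ} (hr₀ : 0 < r₀) (α : ℝ) (n : ℕ) :
    (r₀ / 2 ^ n) ^ α = r₀ ^ α * ((2 : ℝ) ^ (-α)) ^ n := by
  rw [Real.div_rpow hr₀.le (by positivity), ← Real.rpow_natCast, ← Real.rpow_natCast,
    ← Real.rpow_mul (by norm_num), ← Real.rpow_mul (by norm_num), div_eq_mul_inv,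
    ← Real.rpow_neg (by norm_num)]
  congr 2; ring

/-- A sequence of functions whose increments at scale `r₀ / 2 ^ n` have the size and the Lipschitz
constants expected from an `α`-Hölder function has an `α`-Hölder limit. -/
lemma exists_holder_limit {r₀ α : ℝ} (hr₀ : 0 < r₀) (hα : α ∈ Ioo (0 : ℝ) 1) :
    ∃ D : ℝ, 0 ≤ D ∧ ∀ (E : Type) [SeminormedAddCommGroup E] (S : Set E) (F : ℕ → E → ℝ) (A : ℝ),
      0 ≤ A → (∀ x ∈ S, |F 0 x| ≤ A) →
      (∀ x ∈ S, ∀ z ∈ S, ‖x - z‖ ≤ r₀ → |F 0 x - F 0 z| ≤ A * r₀ ^ (α - 1) * ‖x - z‖) →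
      (∀ n, ∀ x ∈ S, |F (n + 1) x - F n x| ≤ A * (r₀ / 2 ^ n) ^ α) →
      (∀ n, ∀ x ∈ S, ∀ z ∈ S, ‖x - z‖ ≤ r₀ / 2 ^ n →
        |(F (n + 1) x - F n x) - (F (n + 1) z - F n z)| ≤
          A * (r₀ / 2 ^ n) ^ (α - 1) * ‖x - z‖) →
      ∃ f : E → ℝ, (∀ x ∈ S, Tendsto (fun n => F n x) atTop (𝓝 (f x))) ∧
        (∀ x ∈ S, |f x| ≤ D * A) ∧ ∀ x ∈ S, ∀ z ∈ S, |f x - f z| ≤ D * A * ‖x - z‖ ^ α := by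
  obtain ⟨hα0, hα1⟩ := hα
  set q : ℝ := 2 ^ (-α) with hq
  have hq0 : 0 < q := by positivity
  have hq1 : q < 1 := Real.rpow_lt_one_of_one_lt_of_neg (by norm_num) (by linarith)
  set w : ℝ := 2 ^ (1 - α) with hw
  have hw1 : 1 < w := Real.one_lt_rpow (by norm_num) (by linarith)
  set c := 1 / (1 - q) with hc
  have hc0 : 0 < c := by rw [hc]; exact one_div_pos.2 (by linarith)
  -- The constant e is chosen so that e + 1 ≤ e w. The Lipschitz scale grows by w = 2^(1-α) > 1 per
  -- halving, so the accumulated Lipschitz constants are dominated by the last one, and the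
  -- induction in `hLip` closes.
  set e := 1 + 1 / (w - 1) with he
  have he1 : 1 ≤ e := by rw [he]; linarith [one_div_pos.2 (by linarith : 0 < w - 1)]
  have hew : e + 1 ≤ e * w := by
    have : e * (w - 1) = w := by
      rw [he, add_mul, one_mul, one_div, inv_mul_cancel₀ (by linarith)]; ring
    nlinarith
  -- The summands serve, in turn, pairs at distance at most r₀ (4c + e), the supremum bound, and
  -- pairs farther apart than r₀.
  refine ⟨4 * c + e + (1 + c * r₀ ^ α) + 2 * (1 + c * r₀ ^ α) * r₀ ^ (-α), by positivity, ?_⟩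
  intro E _ S F A hA h0 h0L hF hFL
  have hgeo : ∀ x ∈ S, ∀ n, dist (F n x) (F (n + 1) x) ≤ A * r₀ ^ α * q ^ n := by
    intro x hx n
    rw [dist_comm, Real.dist_eq]
    refine (hF n x hx).trans (le_of_eq ?_)
    rw [dyadic_rpow hr₀]; ring
  have hlim : ∀ x ∈ S, ∃ l, Tendsto (fun n => F n x) atTop (𝓝 l) := fun x hx =>
    cauchySeq_tendsto_of_complete (cauchySeq_of_le_geometric q _ hq1 (hgeo x hx))
  choose! f hf using hlim
  have hclose : ∀ x ∈ S, ∀ n, |F n x - f x| ≤ c * A * (r₀ / 2 ^ n) ^ α := by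
    intro x hx n
    have := dist_le_of_le_geometric_of_tendsto q _ hq1 (hgeo x hx) (hf x hx) n
    rw [Real.dist_eq] at this
    refine this.trans (le_of_eq ?_)
    rw [dyadic_rpow hr₀, hc]; ring
  have hbound : ∀ x ∈ S, |f x| ≤ (1 + c * r₀ ^ α) * A := by
    intro x hx
    have h1 := hclose x hx 0
    rw [pow_zero, div_one] at h1
    have h2 := h0 x hx
    rw [abs_le] at *
    constructor <;> linarith
  have hLip : ∀ n, ∀ x ∈ S, ∀ z ∈ S, ‖x - z‖ ≤ r₀ / 2 ^ n →
      |F n x - F n z| ≤ e * A * (r₀ / 2 ^ n) ^ (α - 1) * ‖x - z‖ := by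
    intro n
    induction n with
    | zero =>
      intro x hx z hz hxz
      rw [pow_zero, div_one] at hxz ⊢
      refine (h0L x hx z hz hxz).trans ?_
      gcongr
      exact le_mul_of_one_le_left hA he1
    | succ n ih =>
      intro x hx z hz hxz
      have hhalf : r₀ / 2 ^ (n + 1) = r₀ / 2 ^ n / 2 := by rw [pow_succ]; field_simp
      have hrn : 0 < r₀ / 2 ^ n := by positivity
      have hxz' : ‖x - z‖ ≤ r₀ / 2 ^ n := hxz.trans (by rw [hhalf]; linarith)
      have hpow : (r₀ / 2 ^ (n + 1)) ^ (α - 1) = w * (r₀ / 2 ^ n) ^ (α - 1) := by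
        rw [hhalf, show α - 1 = -(1 - α) by ring, half_rpow_neg hrn]
      have h1 := ih x hx z hz hxz'
      have h2 := hFL n x hx z hz hxz'
      have h3 : F (n + 1) x - F (n + 1) z =
          (F n x - F n z) + ((F (n + 1) x - F n x) - (F (n + 1) z - F n z)) := by ring
      rw [h3, hpow]
      refine (abs_add_le _ _).trans ((add_le_add h1 h2).trans ?_)
      have h4 : 0 ≤ A * (r₀ / 2 ^ n) ^ (α - 1) * ‖x - z‖ := by positivity
      nlinarith
  refine ⟨f, hf, fun x hx => (hbound x hx).trans ?_, fun x hx z hz => ?_⟩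
  · refine mul_le_mul_of_nonneg_right ?_ hA
    have : 0 ≤ 2 * (1 + c * r₀ ^ α) * r₀ ^ (-α) := by positivity
    linarith
  · rcases (norm_nonneg (x - z)).eq_or_lt with hδ | hδ
    -- In a seminormed group distinct points may be at distance zero; the Lipschitz bounds force
    -- equal values there.
    · have hall : ∀ n, F n x = F n z := fun n => by
        have := hLip n x hx z hz (by rw [← hδ]; positivity)
        rw [← hδ, mul_zero] at this
        exact sub_eq_zero.1 (abs_eq_zero.1 (le_antisymm this (abs_nonneg _)))
      have h1 := hf x hx
      simp only [hall] at h1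
      rw [tendsto_nhds_unique h1 (hf z hz), sub_self, abs_zero]
      positivity
    set δ := ‖x - z‖ with hδd
    rcases le_or_gt δ r₀ with hle | hgt
    -- At the dyadic scale comparable to δ, f is replaced by F n at both points at the cost of the
    -- geometric tail, and F n is Lipschitz with constant of order δ^(α-1).
    · obtain ⟨n, hn1, hn2⟩ := exists_dyadic_scale hr₀ hδ hle
      have hrn : 0 < r₀ / 2 ^ n := by positivity
      have hhalf : r₀ / 2 ^ (n + 1) = r₀ / 2 ^ n / 2 := by rw [pow_succ]; field_simp
      have h1 := hclose x hx n
      have h2 := hclose z hz n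
      have h3 := hLip n x hx z hz hn2
      have h4 : (r₀ / 2 ^ n) ^ α ≤ 2 * δ ^ α := by
        calc (r₀ / 2 ^ n) ^ α ≤ (2 * δ) ^ α := by gcongr; linarith
          _ = 2 ^ α * δ ^ α := Real.mul_rpow (by norm_num) hδ.le
          _ ≤ 2 * δ ^ α := by
            gcongr; exact Real.rpow_le_self_of_one_le (by norm_num) hα1.le
      have h5 : (r₀ / 2 ^ n) ^ (α - 1) * δ ≤ δ ^ α := by
        calc (r₀ / 2 ^ n) ^ (α - 1) * δ ≤ δ ^ (α - 1) * δ := by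
              gcongr ?_ * δ
              exact Real.rpow_le_rpow_of_nonpos hδ hn2 (by linarith)
          _ = δ ^ α := by rw [← Real.rpow_add_one hδ.ne']; simp
      have h6 : |f x - f z| ≤ 2 * (c * A * (r₀ / 2 ^ n) ^ α) +
          e * A * (r₀ / 2 ^ n) ^ (α - 1) * δ := by
        rw [abs_le] at *
        constructor <;> linarith
      have h7 : c * A * (r₀ / 2 ^ n) ^ α ≤ c * A * (2 * δ ^ α) := by gcongr
      have h8 : e * A * ((r₀ / 2 ^ n) ^ (α - 1) * δ) ≤ e * A * δ ^ α := by gcongr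
      have h9 : 0 ≤ ((1 + c * r₀ ^ α) + 2 * (1 + c * r₀ ^ α) * r₀ ^ (-α)) * A * δ ^ α := by
        positivity
      linarith
    · have h1 := hbound x hx
      have h2 := hbound z hz
      have h3 : 1 ≤ r₀ ^ (-α) * δ ^ α := by
        rw [Real.rpow_neg hr₀.le, ← div_eq_inv_mul, one_le_div (by positivity)]
        gcongr
      have h4 : |f x - f z| ≤ 2 * (1 + c * r₀ ^ α) * A := (abs_sub _ _).trans (by linarith)
      have h5 : 2 * (1 + c * r₀ ^ α) * A * 1 ≤
          2 * (1 + c * r₀ ^ α) * A * (r₀ ^ (-α) * δ ^ α) := by gcongr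
      have h9 : 0 ≤ (4 * c + e + (1 + c * r₀ ^ α)) * A * δ ^ α := by positivity
      linarith

/-- Comparison with the values at dyadic scales gives the limit along all scales. -/
lemma tendsto_of_dyadic {r₀ α A : ℝ} (hr₀ : 0 < r₀) (hα : 0 < α) {T : ℝ → ℝ} {F : ℕ → ℝ} {l : ℝ}
    (hF : Tendsto F atTop (𝓝 l))
    (hT : ∀ n ε, r₀ / 2 ^ n / 2 ≤ ε → ε ≤ r₀ / 2 ^ n → |T ε - F n| ≤ A * (r₀ / 2 ^ n) ^ α) :
    Tendsto T (𝓝[>] (0 : ℝ)) (𝓝 l) := by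
  have hq1 : (2 : ℝ) ^ (-α) < 1 := Real.rpow_lt_one_of_one_lt_of_neg (by norm_num) (by linarith)
  have hlim : Tendsto (fun n => |F n - l| + A * (r₀ / 2 ^ n) ^ α) atTop (𝓝 0) := by
    have h1 : Tendsto (fun n => |F n - l|) atTop (𝓝 0) := by
      simpa using (hF.sub_const l).abs
    have h2 : Tendsto (fun n : ℕ => A * (r₀ / 2 ^ n) ^ α) atTop (𝓝 0) := by
      simp only [dyadic_rpow hr₀]
      have h3 := ((tendsto_pow_atTop_nhds_zero_of_lt_one (by positivity) hq1).const_mul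
        (r₀ ^ α)).const_mul A
      simpa using h3
    simpa using h1.add h2
  rw [Metric.tendsto_nhds]
  intro η hη
  obtain ⟨n₀, hn₀⟩ := eventually_atTop.1 (hlim.eventually_lt_const hη)
  have hpos : 0 < r₀ / 2 ^ n₀ := by positivity
  filter_upwards [Ioo_mem_nhdsGT hpos] with ε hε
  have hler : ε ≤ r₀ := hε.2.le.trans (div_le_self hr₀.le (one_le_pow₀ (by norm_num)))
  obtain ⟨n, hn1, hn2⟩ := exists_dyadic_scale hr₀ hε.1 hler
  have hnn : n₀ ≤ n := by
    have h1 : r₀ / 2 ^ (n + 1) < r₀ / 2 ^ n₀ := hn1.trans hε.2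
    rw [div_lt_div_iff_of_pos_left hr₀ (by positivity) (by positivity)] at h1
    have := (pow_lt_pow_iff_right₀ (by norm_num : (1 : ℝ) < 2)).1 h1
    omega
  have h1 := hT n ε (by rw [pow_succ, ← div_div] at hn1; exact hn1.le) hn2
  rw [Real.dist_eq]
  have h2 := hn₀ n hnn
  have h3 : T ε - l = (T ε - F n) + (F n - l) := by ring
  rw [h3]
  exact (abs_add_le _ _).trans_lt (by linarith)

lemma supNorm_le_ofReal {N : ℕ} {S : Set (Eu N)} {f : Eu N → ℝ} {K : ℝ}
    (h : ∀ x ∈ S, |f x| ≤ K) : supNorm S f ≤ ENNReal.ofReal K := by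
  refine iSup₂_le fun x hx => ?_
  rw [← ofReal_norm]
  exact ENNReal.ofReal_le_ofReal (h x hx)

lemma holderNorm_le_ofReal {N : ℕ} {S : Set (Eu N)} {f : Eu N → ℝ} {K K' α : ℝ} (hK : 0 ≤ K)
    (hK' : 0 ≤ K') (hα : 0 ≤ α) (h : ∀ x ∈ S, |f x| ≤ K)
    (h' : ∀ x ∈ S, ∀ z ∈ S, |f x - f z| ≤ K' * ‖x - z‖ ^ α) :
    holderNorm α S f ≤ ENNReal.ofReal (K + K') := by
  rw [ENNReal.ofReal_add hK hK']
  refine add_le_add (supNorm_le_ofReal h) ?_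
  have hH : HolderWith K'.toNNReal α.toNNReal (S.domRestrict f) := by
    intro x z
    rw [Real.coe_toNNReal _ hα, edist_dist, edist_dist, ENNReal.ofReal_rpow_of_nonneg
      dist_nonneg hα]
    change _ ≤ ENNReal.ofReal K' * _
    rw [← ENNReal.ofReal_mul hK']
    refine ENNReal.ofReal_le_ofReal ?_
    rw [Real.dist_eq, Subtype.dist_eq, dist_eq_norm]
    exact h' x x.2 z z.2
  exact hH.eHolderNorm_le

/-! ### Increments of the capped operators -/

section FlatModels

variable {N : ℕ} {γ M C p r : ℝ} {Ω : Set (Eu N)} {u : Eu N → ℝ} {x z : Eu N}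

lemma C1HolderBound.cappedOp_half_sub (hΩ : IsOpen Ω) (hu : C1HolderBound γ M Ω u) (hr : 0 < r)
    (hp : (N : ℝ) < p) (hx : x ∈ closure Ω) :
    IntegrableOn (fun y => (u x - u y) * (max ‖x - y‖ (r / 2) ^ (-p) - max ‖x - y‖ r ^ (-p))) Ω ∧
      cappedOp Ω u p (r / 2) x - cappedOp Ω u p r x =
        ∫ y in Ω, (u x - u y) * (max ‖x - y‖ (r / 2) ^ (-p) - max ‖x - y‖ r ^ (-p)) := by
  have h1 := hu.integrableOn_cappedOp hΩ (half_pos hr) hp hx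
  have h2 := hu.integrableOn_cappedOp hΩ hr hp hx
  simp only [mul_sub]
  exact ⟨h1.sub h2, (integral_sub h1 h2).symm⟩

/-- The constant in the estimates of the increments of the capped operators. -/
noncomputable def incrementConst (N : ℕ) (C p : ℝ) : ℝ :=
  C * (2 ^ N * volume.real (Metric.ball (0 : Eu N) 1) + 1) * ((p + 1) * 2 ^ (p + 2))

lemma incrementConst_nonneg (hC : 0 ≤ C) (hp : 0 ≤ p) : 0 ≤ incrementConst N C p := by
  unfold incrementConst; positivity

lemma max_kernel_sub_eq_zero (t : ℝ) (hr : 0 < r) (ht : r < t) :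
    max t (r / 2) ^ (-p) - max t r ^ (-p) = 0 := by
  rw [max_eq_left (by linarith), max_eq_left ht.le, sub_self]

lemma measurable_max_kernel_sub (p r : ℝ) :
    Measurable fun t : ℝ => max t (r / 2) ^ (-p) - max t r ^ (-p) :=
  (measurable_max_rpow _ _).sub (measurable_max_rpow _ _)

lemma C1HolderBound.abs_cappedOp_half_sub_le (hC : 0 ≤ C) (hΩ : IsOpen Ω)
    (hu : C1HolderBound γ M Ω u) (hr : 0 < r) (hp : (N : ℝ) < p) (hx : x ∈ closure Ω)
    (h : ∃ a H, IsFlatModel γ M C Ω u x r a H) :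
    |cappedOp Ω u p (r / 2) x - cappedOp Ω u p r x| ≤
      incrementConst N C p * M * r ^ (N + γ - p) := by
  obtain ⟨a, H, h⟩ := h
  have hp0 : 0 < p := lt_of_le_of_lt N.cast_nonneg hp
  rw [(hu.cappedOp_half_sub hΩ hr hp hx).2]
  refine (h.abs_integral_le hC hΩ hu hx hr (measurable_max_kernel_sub p r)
    (fun t _ => abs_capped_kernel_sub_le hr hp0.le t)
    (fun t ht => max_kernel_sub_eq_zero t hr ht)).trans (le_of_eq ?_)
  have e : r ^ ((N : ℝ) + γ - p) = r ^ ((N : ℝ) + γ) * r ^ (-p) := by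
    rw [← Real.rpow_add hr, sub_eq_add_neg]
  rw [e, incrementConst]
  ring

lemma C1HolderBound.abs_cappedOp_half_sub_sub_le (hC : 0 ≤ C) (hΩ : IsOpen Ω)
    (hu : C1HolderBound γ M Ω u) (hr : 0 < r) (hp : (N : ℝ) < p) (hx : x ∈ closure Ω)
    (hz : z ∈ closure Ω) (hxz : ‖x - z‖ ≤ r) (h : ∃ a H, IsFlatModel γ M C Ω u x r a H) :
    |(cappedOp Ω u p (r / 2) x - cappedOp Ω u p r x) -
        (cappedOp Ω u p (r / 2) z - cappedOp Ω u p r z)| ≤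
      4 * incrementConst N C p * M * r ^ (N + γ - p - 1) * ‖x - z‖ := by
  obtain ⟨a, H, h⟩ := h
  have hp0 : 0 < p := lt_of_le_of_lt N.cast_nonneg hp
  obtain ⟨ix, ex⟩ := hu.cappedOp_half_sub hΩ hr hp hx
  obtain ⟨iz, ez⟩ := hu.cappedOp_half_sub hΩ hr hp hz
  rw [ex, ez, ← integral_sub ix iz]
  refine (h.abs_integral_sub_le hC hΩ hu hx hz hr hxz (measurable_max_kernel_sub p r)
    (fun t _ => abs_capped_kernel_sub_le hr hp0.le t)
    (fun t t' _ _ => abs_capped_kernel_sub_sub_le hr hp0.le t t')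
    (fun t ht => max_kernel_sub_eq_zero t hr ht)).trans (le_of_eq ?_)
  have e : r ^ ((N : ℝ) + γ - p - 1) = r ^ ((N : ℝ) - 1 + γ) * r ^ (-p) := by
    rw [← Real.rpow_add hr]; congr 1; ring
  rw [e, incrementConst]
  ring

lemma C1HolderBound.abs_setIntegral_integrand_sub_le {s ε : ℝ} (hC : 0 ≤ C) (hs : 0 < s)
    (hΩ : IsOpen Ω) (hu : C1HolderBound γ M Ω u) (hr : 0 < r) (hx : x ∈ closure Ω)
    (hε : r / 2 ≤ ε) (hεr : ε ≤ r) (h : ∃ a H, IsFlatModel γ M C Ω u x r a H) :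
    |(∫ y in Ω \ Metric.ball x ε, integrand s u x y) - cappedOp Ω u (N + 2 * s) r x| ≤
      incrementConst N C (N + 2 * s) * M * r ^ (γ - 2 * s) := by
  obtain ⟨a, H, h⟩ := h
  have hp : (N : ℝ) < N + 2 * s := by linarith
  have hp0 : (0 : ℝ) ≤ N + 2 * s := by positivity
  have hε0 : 0 < ε := lt_of_lt_of_le (half_pos hr) hε
  rw [setIntegral_integrand_eq, cappedOp,
    ← integral_sub (hu.integrableOn_truncKernel hΩ hp hx hε0) (hu.integrableOn_cappedOp hΩ hr hp hx)]
  simp only [← mul_sub]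
  refine (h.abs_integral_le hC hΩ hu hx hr
    (Φ := fun t => truncKernel (N + 2 * s) ε t - max t r ^ (-(N + 2 * s)))
    ((measurable_truncKernel _ ε).sub (measurable_max_rpow r _))
    (fun t _ => abs_truncKernel_sub_le hr hp0 hε t) (fun t ht => ?_)).trans (le_of_eq ?_)
  -- Beyond r ≥ ε both the truncated and the capped kernel equal the original one, so their
  -- difference is supported at scale r.
  · rw [truncKernel, indicator_of_mem (mem_Ici.2 (hεr.trans ht.le)), max_eq_left ht.le, sub_self]
  · have e : r ^ (γ - 2 * s) = r ^ ((N : ℝ) + γ) * r ^ (-(N + 2 * s)) := by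
      rw [← Real.rpow_add hr]; congr 1; ring
    rw [e, incrementConst]
    ring

end FlatModels

/-! ### The Hölder limit and the main estimate -/

/-- The truncated integrals converge to an `α`-Hölder continuous limit. -/
lemma exists_holder_limit_integrand {N : ℕ} (hN : 1 ≤ N) {s α : ℝ} (hs : s ∈ Ioo (0 : ℝ) 1)
    (hα : α ∈ Ioo (0 : ℝ) 1) (h1 : 1 < 2 * s + α) (h2 : 2 * s + α < 2) {Ω : Set (Eu N)}
    (hΩ : IsOpen Ω) (hU : HasUniformCharts (2 * s + α) Ω) :
    ∃ D : ℝ, 0 ≤ D ∧ ∀ u M, C1HolderBound (2 * s + α) M Ω u → NeumannZero Ω u → 0 ≤ M →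
      ∃ f : Eu N → ℝ, (∀ x ∈ closure Ω, Tendsto
          (fun ε => ∫ y in Ω \ Metric.ball x ε, integrand s u x y) (𝓝[>] (0 : ℝ)) (𝓝 (f x))) ∧
        (∀ x ∈ closure Ω, |f x| ≤ D * M) ∧
        ∀ x ∈ closure Ω, ∀ z ∈ closure Ω, |f x - f z| ≤ D * M * ‖x - z‖ ^ α := by
  obtain ⟨r₀, C, hr₀, hC, hflat⟩ := hU.exists_isFlatModel hN h1 h2 hΩ
  obtain ⟨D, hD, hlimit⟩ := exists_holder_limit hr₀ hα
  have hs0 := hs.1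
  set p : ℝ := N + 2 * s with hp
  have hpN : (N : ℝ) < p := by rw [hp]; linarith
  have hp0 : 0 < p := lt_of_le_of_lt N.cast_nonneg hpN
  set I := ∫ y : Eu N, max ‖y‖ r₀ ^ (-p) with hI
  have hI0 : 0 ≤ I := integral_nonneg fun y => Real.rpow_nonneg (le_max_of_le_right hr₀.le) _
  set Q := incrementConst N C p with hQ
  have hQ0 : 0 ≤ Q := incrementConst_nonneg hC hp0.le
  set K := 1 + C * r₀ ^ (2 * s + α - 1) with hK
  have hK0 : 0 ≤ K := by positivity
  -- The factor (r₀^(α-1))⁻¹ puts the Lipschitz bound at the initial scale into the normalization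
  -- used by `exists_holder_limit`.
  set J := (K + 2 * (p * 2 ^ (p + 1) / r₀)) * I * (r₀ ^ (α - 1))⁻¹ with hJ
  have hJ0 : 0 ≤ J := by positivity
  refine ⟨D * (4 * Q + 2 * I + J), by positivity, fun u M hu hν hM => ?_⟩
  have hmodel : ∀ n : ℕ, ∀ x ∈ closure Ω,
      ∃ a H, IsFlatModel (2 * s + α) M C Ω u x (r₀ / 2 ^ n) a H := fun n x hx =>
    hflat u M hu hν x hx _ (by positivity) (div_le_self hr₀.le (one_le_pow₀ (by norm_num)))
  have hhalf : ∀ n : ℕ, r₀ / 2 ^ (n + 1) = r₀ / 2 ^ n / 2 := fun n => by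
    rw [pow_succ, div_div]
  have e1 : (N : ℝ) + (2 * s + α) - p = α := by rw [hp]; ring
  have hMul : ∀ {k : ℝ}, k ≤ 4 * Q + 2 * I + J → k * M ≤ (4 * Q + 2 * I + J) * M :=
    fun hk => mul_le_mul_of_nonneg_right hk hM
  obtain ⟨f, hf, hfb, hfH⟩ := hlimit (Eu N) (closure Ω)
    (fun n x => cappedOp Ω u p (r₀ / 2 ^ n) x) ((4 * Q + 2 * I + J) * M) (by positivity)
    (fun x hx => by
      have h := hu.abs_cappedOp_le hΩ (ρ := r₀ / 2 ^ 0) (by positivity) hpN hx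
      refine h.trans ?_
      rw [pow_zero, div_one, ← hI]
      have := hMul (k := 2 * I) (by linarith)
      linarith)
    (fun x hx z hz hxz => by
      obtain ⟨a, H, hm⟩ := hmodel 0 x hx
      simp only [pow_zero, div_one] at hm ⊢
      have hd := hm.abs_sub_inner_le x ⟨hx, Metric.mem_closedBall_self (by positivity)⟩ z
        ⟨hz, by rw [mem_closedBall_iff_norm, ← norm_neg, neg_sub]; linarith⟩
      have ha : |(inner ℝ a (x - z) : ℝ)| ≤ M * ‖x - z‖ :=
        (abs_real_inner_le_norm _ _).trans (by gcongr; exact hm.norm_le)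
      -- Ω need not be convex, so the Lipschitz bound for nearby points is read off the flat model
      -- at scale r₀.
      have hxz' : |u x - u z| ≤ K * M * ‖x - z‖ := by
        have h3 : u x - u z = (u x - u z - inner ℝ a (x - z)) + inner ℝ a (x - z) := by ring
        rw [h3]
        refine (abs_add_le _ _).trans ((add_le_add hd ha).trans (le_of_eq ?_))
        rw [hK]; ring
      refine (hu.abs_cappedOp_sub_le hΩ hr₀ hpN hx hz hxz hxz').trans ?_
      have hr1 : (r₀ ^ (α - 1))⁻¹ * r₀ ^ (α - 1) = 1 := inv_mul_cancel₀ (by positivity)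
      calc (K + 2 * (p * 2 ^ (p + 1) / r₀)) * M * ‖x - z‖ * I
          = (K + 2 * (p * 2 ^ (p + 1) / r₀)) * M * ‖x - z‖ * I *
            ((r₀ ^ (α - 1))⁻¹ * r₀ ^ (α - 1)) := by rw [hr1, mul_one]
        _ = J * M * r₀ ^ (α - 1) * ‖x - z‖ := by rw [hJ]; ring
        _ ≤ (4 * Q + 2 * I + J) * M * r₀ ^ (α - 1) * ‖x - z‖ := by gcongr; linarith)
    (fun n x hx => by
      rw [hhalf]
      refine (hu.abs_cappedOp_half_sub_le hC hΩ (by positivity) hpN hx (hmodel n x hx)).trans ?_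
      rw [e1]
      gcongr
      linarith)
    (fun n x hx z hz hxz => by
      rw [hhalf]
      refine (hu.abs_cappedOp_half_sub_sub_le hC hΩ (by positivity) hpN hx hz hxz
        (hmodel n x hx)).trans ?_
      rw [e1]
      gcongr
      linarith)
  refine ⟨f, fun x hx => ?_, fun x hx => (hfb x hx).trans (le_of_eq (by ring)),
    fun x hx z hz => (hfH x hx z hz).trans (le_of_eq (by ring))⟩
  refine tendsto_of_dyadic (A := Q * M) hr₀ hα.1 (hf x hx) fun n ε hε1 hε2 => ?_
  have h := hu.abs_setIntegral_integrand_sub_le hC hs0 hΩ (by positivity) hx hε1 hε2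
    (hmodel n x hx)
  rwa [show 2 * s + α - 2 * s = α by ring] at h

end RegionalFL

theorem mainTheorem7 (N : ℕ) (hN : 1 ≤ N) (s α : ℝ) (hs : s ∈ Set.Ioo (0 : ℝ) 1)
    (hα : α ∈ Set.Ioo (0 : ℝ) 1) (h1 : 1 < 2 * s + α) (h2 : 2 * s + α < 2)
    (Ω : Set (RegionalFL.Eu N)) (hΩ : RegionalFL.IsHolderDomain (2 * s + α) Ω)
    (hU : Bornology.IsBounded Ω ∨ RegionalFL.HasUniformCharts (2 * s + α) Ω) :
    ∃ C : ℝ≥0, ∀ u : RegionalFL.Eu N → ℝ,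
      RegionalFL.MemC1Holder (2 * s + α) Ω u → RegionalFL.NeumannZero Ω u →
        (∀ x ∈ closure Ω, RegionalFL.IsDefinedAt s Ω u x) ∧
        RegionalFL.holderNorm α (closure Ω) (RegionalFL.regionalFracLap s Ω u) < ⊤ ∧
        RegionalFL.holderNorm α (closure Ω) (RegionalFL.regionalFracLap s Ω u) ≤
          C * RegionalFL.c1HolderNorm (2 * s + α) Ω u := by
  have hU' : RegionalFL.HasUniformCharts (2 * s + α) Ω := hU.elim hΩ.hasUniformCharts id
  obtain ⟨D, hD, hmain⟩ :=
    RegionalFL.exists_holder_limit_integrand hN hs hα h1 h2 hΩ.1 hU'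
  set c := RegionalFL.cNs N s with hc
  -- The supremum and the Hölder seminorm each contribute |c| D.
  refine ⟨(2 * (|c| * D)).toNNReal, fun u hu hν => ?_⟩
  have hb := hu.c1HolderBound h1
  have hfin : RegionalFL.c1HolderNorm (2 * s + α) Ω u ≠ ⊤ := hu.norm_lt_top.ne
  set M := (RegionalFL.c1HolderNorm (2 * s + α) Ω u).toReal with hM
  have hM0 : 0 ≤ M := ENNReal.toReal_nonneg
  obtain ⟨f, hf, hfb, hfH⟩ := hmain u M hb hν hM0
  have hlim : ∀ x ∈ closure Ω,
      Tendsto (RegionalFL.truncated s Ω u x) (𝓝[>] (0 : ℝ)) (𝓝 (c * f x)) :=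
    fun x hx => (hf x hx).const_mul c
  have heq : ∀ x ∈ closure Ω, RegionalFL.regionalFracLap s Ω u x = c * f x :=
    fun x hx => (hlim x hx).limUnder_eq
  have hnorm : RegionalFL.holderNorm α (closure Ω) (RegionalFL.regionalFracLap s Ω u) ≤
      (2 * (|c| * D)).toNNReal * RegionalFL.c1HolderNorm (2 * s + α) Ω u := by
    refine (RegionalFL.holderNorm_le_ofReal (K := |c| * (D * M)) (K' := |c| * (D * M))
      (by positivity) (by positivity) hα.1.le (fun x hx => ?_) (fun x hx z hz => ?_)).trans ?_
    · rw [heq x hx, abs_mul]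
      gcongr
      exact hfb x hx
    · rw [heq x hx, heq z hz, ← mul_sub, abs_mul, mul_assoc]
      gcongr
      exact hfH x hx z hz
    · rw [← ENNReal.ofReal_toReal hfin, ← hM]
      change _ ≤ ENNReal.ofReal _ * _
      rw [← ENNReal.ofReal_mul (by positivity)]
      exact ENNReal.ofReal_le_ofReal (le_of_eq (by ring))
  refine ⟨fun x hx => ⟨fun ε hε => hb.integrableOn_integrand hΩ.1 hs.1 hx hε, ?_⟩, ?_, hnorm⟩
  · rw [heq x hx]
    exact hlim x hx
  · exact hnorm.trans_lt (ENNReal.mul_lt_top ENNReal.coe_lt_top hu.norm_lt_top)
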